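/- Let $\mathcal X$ be a separable real Hilbert space, $C$ a symmetric, positive, trace class operator on $\mathcal X$, $N_C$ the centred Gaussian measure with covariance $C$, and $U:\mathcal X\to\mathbb R$ a measurable function. Let $P\propto e^{-U}N_C$ and $Q$ be Borel probability measures on $\mathcal X$ with $\mathbb E_Q\|X\|^2<\infty$ and $\mathbb E_Q\|CDU(X)\|<\infty$, and let $e^{-U/2}\in W^{1,2}_C(\mathcal X)$ (the Malliavin–Sobolev space: the completion of the smooth cylindrical functions in the norm $(\|f\|^2_{L^2(N_C)}+\|C^{1/2}Df\|^2_{L^2(N_C)})^{1/2}$) and $\mathbb E_{N_C}\|C^{1/2}DU(X)\|^2<\infty$. Here $D$ is the Fréchet derivative, identified with an element of $\mathcal X$ for real-valued functions, and $U$ is assumed Fréchet differentiable $N_C$-almost everywhere and $Q$-almost everywhere. Put $\mathcal A f(x)=\mathrm{Tr}[CD^2f(x)]-\langle Df(x),x+CDU(x)\rangle$ and $\Gamma f(x)=CDf(x)-(x+CDU(x))f(x)$ for $f:\mathcal X\to\mathbb R$, both extended complex-linearly to complex-valued $f$ (with $\Gamma f$ taking values in the complexification $\mathcal X_{\mathbb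 C}$, $\|a+ib\|^2=\|a\|^2+\|b\|^2$), and $\mathcal A_vF(x)=\mathrm{Tr}[CDF(x)]-\langle F(x),x+CDU(x)\rangle$ for $F:\mathcal X\to\mathcal X$. For a real-valued (symmetric, positive definite) kernel $k$ on $\mathcal X$ with reproducing kernel Hilbert space $\mathcal H_k$, and for the $\mathcal X$-valued reproducing kernel Hilbert space $\mathcal H_K$ of $K=kI_{\mathcal X}$, put $$\mathrm{KSD}_{\mathcal A,k}(Q,P)=\sup_{f\in\mathcal H_k,\ \|f\|_k\le1}\left|\mathbb E_Q[\mathcal Af(X)]\right|,\qquad \mathrm{KSD}_{\mathcal A_v,K}(Q,P)=\sup_{F\in\mathcal H_K,\ \|F\|_K\le1}\left|\mathbb E_Q[\mathcal A_vF(X)]\right|.$$ For $\alpha\in\mathbb N$ write $k\in C_b^{(\alpha,\alpha)}$ if all partial Fréchet derivatives $D_1^iD_2^jk$ with $0\le i,j\le\alpha$ exist, are continuous and are bounded on $\mathcal X\times\mathcal X$. Suppose that $k(x,y)=\widehat\mu(x-y)=\int_{\mathcal X}e^{i\langle s,x-y\rangle}\,d\mu(s)$ for all $x,y$, for some finite Borel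 measure $\mu$ on $\mathcal X$. (a) If $k\in C_b^{(2,2)}$, then every $f\in\mathcal H_k$ is twice Fréchet differentiable, with $CD^2f(x)$ of trace class for every $x$ and $\mathcal Af\in L^1(Q)$; $\mathcal A(e^{i\langle s,\cdot\rangle})\in L^1(Q)$ for every $s\in\mathcal X$; $\mathrm{KSD}_{\mathcal A,k}(Q,P)<\infty$; and $$\mathrm{KSD}_{\mathcal A,k}(Q,P)^2=\int_{\mathcal X}\left|\mathbb E_Q\left[\mathcal A(e^{i\langle s,\cdot\rangle})(X)\right]\right|^2d\mu(s).$$ (b) If $k\in C_b^{(1,1)}$, then every $F\in\mathcal H_K$ is Fréchet differentiable, with $CDF(x)$ of trace class for every $x$ and $\mathcal A_vF\in L^1(Q)$; $\Gamma(e^{i\langle s,\cdot\rangle})\in L^1(Q;\mathcal X_{\mathbb C})$ for every $s\in\mathcal X$; $\mathrm{KSD}_{\mathcal A_v,K}(Q,P)<\infty$; and $$\mathrm{KSD}_{\mathcal A_v,K}(Q,P)^2=\int_{\mathcal X}\left\|\mathbb E_Q\left[\Gamma(e^{i\langle s,\cdot\rangle})(X)\right]\right\|_{\mathcal X_{\mathbb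 C}}^2d\mu(s).$$ -/

import Mathlib

open MeasureTheory ProbabilityTheory Filter Topology
open scoped ENNReal ContDiff

noncomputable section

universe u

namespace SpectralKSD

/-! ### Positive definite kernels and their reproducing kernel Hilbert spaces -/

/-- A real-valued kernel on `X`: symmetric and positive definite. -/
structure PDKernel (X : Type*) where
  /-- the underlying function of two variables -/
  toFun : X → X → ℝ
  symm' : ∀ x y, toFun x y = toFun y x
  posDef' : ∀ (n : ℕ) (x : Fin n → X) (c : Fin n → ℝ),
    0 ≤ ∑ i, ∑ j, c i * c j * toFun (x i) (x j)

instance (X : Type*) : CoeFun (PDKernel X) (fun _ => X → X → ℝ) := ⟨PDKernel.toFun⟩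

/-- The operator-valued kernel `(x, y) ↦ k(x, y) I_V` on a Hilbert space `V`. For `V = ℝ` this is
`k` itself, a real number being identified with multiplication by it. -/
def PDKernel.op {X : Type*} (k : PDKernel X) (V : Type*) [NormedAddCommGroup V]
    [InnerProductSpace ℝ V] : Matrix X X (V →L[ℝ] V) :=
  Matrix.of fun x y => k x y • ContinuousLinearMap.id ℝ V

theorem PDKernel.sum_nonneg {X : Type*} (k : PDKernel X) (s : Finset X) (c : X → ℝ) :
    0 ≤ ∑ x ∈ s, ∑ y ∈ s, c x * c y * k x y := by
  have h := k.posDef' s.card (fun i => (s.equivFin.symm i : X)) (fun i => c (s.equivFin.symm i))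
  rw [← Finset.sum_coe_sort s, ← Equiv.sum_comp s.equivFin.symm]
  refine h.trans_eq (Finset.sum_congr rfl fun i _ => ?_)
  rw [← Finset.sum_coe_sort s, ← Equiv.sum_comp s.equivFin.symm]

theorem PDKernel.posSemidef_op {X : Type*} (k : PDKernel X) (V : Type*) [NormedAddCommGroup V]
    [InnerProductSpace ℝ V] [CompleteSpace V] : (k.op V).PosSemidef := by
  have hH : (k.op V).IsHermitian := by
    refine Matrix.IsHermitian.ext fun x y => ?_
    simp [PDKernel.op, k.symm' x y, ContinuousLinearMap.star_eq_adjoint,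
      ContinuousLinearMap.adjoint_id]
  have key := (RKHS.posSemidef_tfae (K := k.op V)).out 0 2
  refine key.mpr ⟨hH, fun v => ?_⟩
  obtain ⟨w, b, -⟩ := exists_hilbertBasis ℝ V
  have h : HasSum (fun i => ∑ x ∈ v.support, ∑ y ∈ v.support,
      inner ℝ (v x) (b i) * inner ℝ (b i) (v y) * k x y)
      (∑ x ∈ v.support, ∑ y ∈ v.support, inner ℝ (v x) (v y) * k x y) :=
    hasSum_sum fun x _ => hasSum_sum fun y _ => (b.hasSum_inner_mul_inner (v x) (v y)).mul_right _
  have h0 := h.nonneg fun i => by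
    simpa only [real_inner_comm] using k.sum_nonneg v.support fun x => inner ℝ (b i) (v x)
  refine h0.trans_eq ?_
  simp only [Finsupp.sum, PDKernel.op, Matrix.of_apply, map_sum, RCLike.re_to_real]
  refine Finset.sum_congr rfl fun x _ => Finset.sum_congr rfl fun y _ => ?_
  simp [inner_smul_left, k.symm' y x, mul_comm]

instance {X : Type*} (k : PDKernel X) (V : Type*) [NormedAddCommGroup V]
    [InnerProductSpace ℝ V] [CompleteSpace V] : Fact (k.op V).PosSemidef := ⟨k.posSemidef_op V⟩

/-- The Hilbert space of functions `X → V` whose reproducing kernel is `k I_V`: for `V = ℝ` the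
RKHS `H_k` of `k`, and for `V = X` the RKHS `H_K` of the operator-valued kernel `K = k I_X`. -/
abbrev HilbertRKHS {X : Type*} (k : PDKernel X) (V : Type*) [NormedAddCommGroup V]
    [InnerProductSpace ℝ V] [CompleteSpace V] : Type _ :=
  RKHS.OfKernel (k.op V)

/-- `F ∈ C_b^{(α,α)}(X × X)`: all partial Fréchet derivatives `D₁^i D₂^j F` with `i, j ≤ α` exist,
are continuous on `X × X`, and are bounded (in the operator norm of multilinear maps). -/
structure IsCb {X : Type*} [NormedAddCommGroup X] [NormedSpace ℝ X] (α : ℕ) (F : X → X → ℝ) :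
    Prop where
  contDiff_snd : ∀ x, ContDiff ℝ α (F x)
  contDiff_fst : ∀ j ≤ α, ∀ y, ContDiff ℝ α (fun x => iteratedFDeriv ℝ j (F x) y)
  continuous_mixed : ∀ i ≤ α, ∀ j ≤ α, Continuous (fun p : X × X =>
    iteratedFDeriv ℝ i (fun x => iteratedFDeriv ℝ j (F x) p.2) p.1)
  bounded_mixed : ∃ B : ℝ, ∀ i ≤ α, ∀ j ≤ α, ∀ x y : X,
    ‖iteratedFDeriv ℝ i (fun x' => iteratedFDeriv ℝ j (F x') y) x‖ ≤ B

/-! ### Trace class operators, Gaussian and Gibbs measures -/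

section Hilbert

variable {X : Type u} [NormedAddCommGroup X] [InnerProductSpace ℝ X] [CompleteSpace X]

/-- A bounded operator `T` is of trace class if `∑ ⟨T vᵢ, wᵢ⟩` converges for any two orthonormal
bases `v`, `w` with the same index set. -/
def IsTraceClass (T : X →L[ℝ] X) : Prop :=
  ∀ (ι : Type u) (v w : HilbertBasis ι ℝ X), Summable fun i => inner ℝ (T (v i)) (w i)

variable (X) in
/-- Index set of a fixed orthonormal basis. -/
def basisIndex : Set X := Classical.choose (exists_hilbertBasis ℝ X)

variable (X) in
/-- A fixed orthonormal basis of `X`. -/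
def basis : HilbertBasis (basisIndex X) ℝ X :=
  Classical.choose (Classical.choose_spec (exists_hilbertBasis ℝ X))

/-- The trace `∑ ⟨T eᵢ, eᵢ⟩`; for `T` of trace class it does not depend on the basis. -/
def opTrace (T : X →L[ℝ] X) : ℝ := ∑' i, inner ℝ (T (basis X i)) (basis X i)

/-- `N` is the centred Gaussian measure `N_C`: its image under `⟨y, ·⟩` is the Gaussian
distribution on `ℝ` with mean `0` and variance `⟨C y, y⟩`, for every `y`. -/
def IsCentredGaussian [MeasurableSpace X] (C : X →L[ℝ] X) (N : Measure X) : Prop :=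
  ∀ y : X, N.map (fun x => inner ℝ y x) = gaussianReal 0 (inner ℝ (C y) y).toNNReal

/-- Smooth cylindrical functions: `φ(⟨l₁, ·⟩, …, ⟨lₙ, ·⟩)` with `φ` smooth and bounded together
with its derivatives of all orders. -/
def IsSmoothCylindrical (f : X → ℝ) : Prop :=
  ∃ (n : ℕ) (l : Fin n → X) (φ : (Fin n → ℝ) → ℝ), ContDiff ℝ ∞ φ ∧
    (∀ m : ℕ, ∃ B : ℝ, ∀ z, ‖iteratedFDeriv ℝ m φ z‖ ≤ B) ∧
    f = fun x => φ (fun j => inner ℝ (l j) x)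

/-- Membership in the Malliavin-Sobolev space `W^{1,2}_C(X)` over `N = N_C`: `f` is a limit in
`L²(N)` of smooth cylindrical functions `gₙ` whose Malliavin derivatives `C^{1/2} D gₙ` form a
Cauchy sequence in `L²(N; X)`. Note that `‖C^{1/2} h‖² = ⟨C h, h⟩`. -/
def MemMalliavinSobolev [MeasurableSpace X] (C : X →L[ℝ] X) (N : Measure X) (f : X → ℝ) : Prop :=
  MemLp f 2 N ∧ ∃ g : ℕ → X → ℝ, (∀ n, IsSmoothCylindrical (g n)) ∧
    Tendsto (fun n => eLpNorm (g n - f) 2 N) atTop (𝓝 0) ∧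
    ∀ ε > 0, ∃ M, ∀ m ≥ M, ∀ n ≥ M,
      ∫ x, inner ℝ (C (gradient (g m) x - gradient (g n) x))
        (gradient (g m) x - gradient (g n) x) ∂N < ε

/-- The standing assumptions on the target measure `P ∝ exp(-U) N`, where `N = N_C`, and on the
candidate measure `Q`. Here `DU` is the Fréchet derivative of `U`, as an element of `X`. -/
structure SteinSetting [MeasurableSpace X] (C : X →L[ℝ] X) (U : X → ℝ) (N P Q : Measure X) :
    Prop where
  isPositive : C.IsPositive
  isTraceClass : IsTraceClass C
  gaussian : IsCentredGaussian C N
  measurable_potential : Measurable U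
  differentiable_ae_gaussian : ∀ᵐ x ∂N, DifferentiableAt ℝ U x
  differentiable_ae_candidate : ∀ᵐ x ∂Q, DifferentiableAt ℝ U x
  isProbabilityMeasure_target : IsProbabilityMeasure P
  isProbabilityMeasure_candidate : IsProbabilityMeasure Q
  gibbs : ∃ Z : ℝ, 0 < Z ∧ P = N.withDensity fun x => ENNReal.ofReal (Z⁻¹ * Real.exp (-U x))
  candidate_moment : Integrable (fun x => ‖x‖ ^ 2) Q
  candidate_potential : Integrable (fun x => ‖C (gradient U x)‖) Q
  target_sobolev : MemMalliavinSobolev C N fun x => Real.exp (-U x / 2)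
  target_energy : Integrable (fun x => inner ℝ (C (gradient U x)) (gradient U x)) N

/-! ### Stein operators -/

/-- The second Fréchet derivative `D²f(x)`, as a bounded operator on `X`. -/
def secondDeriv (f : X → ℝ) (x : X) : X →L[ℝ] X := fderiv ℝ (gradient f) x

/-- The map `x ↦ x + C DU(x)`. -/
def drift (C : X →L[ℝ] X) (U : X → ℝ) (x : X) : X := x + C (gradient U x)

/-- The Stein operator `𝒜 f(x) = Tr[C D²f(x)] - ⟨Df(x), x + C DU(x)⟩`. -/
def steinOp (C : X →L[ℝ] X) (U : X → ℝ) (f : X → ℝ) (x : X) : ℝ :=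
  opTrace (C ∘L secondDeriv f x) - inner ℝ (gradient f x) (drift C U x)

/-- The vectorised Stein operator `𝒜ᵥ F(x) = Tr[C DF(x)] - ⟨F(x), x + C DU(x)⟩`. -/
def vecSteinOp (C : X →L[ℝ] X) (U : X → ℝ) (F : X → X) (x : X) : ℝ :=
  opTrace (C ∘L fderiv ℝ F x) - inner ℝ (F x) (drift C U x)

/-- The operator `Γ f(x) = C Df(x) - (x + C DU(x)) f(x)`. -/
def gammaOp (C : X →L[ℝ] X) (U : X → ℝ) (f : X → ℝ) (x : X) : X :=
  C (gradient f x) - f x • drift C U x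

/-- `𝒜` extended to complex-valued functions: `𝒜(f + i g) = 𝒜 f + i 𝒜 g`. -/
def steinOpC (C : X →L[ℝ] X) (U : X → ℝ) (f : X → ℂ) (x : X) : ℂ :=
  ⟨steinOp C U (fun z => (f z).re) x, steinOp C U (fun z => (f z).im) x⟩

/-- The complexification of `X` as a Banach space: the pair `(a, b)` stands for `a + i b`, and
`‖a + i b‖² = ‖a‖² + ‖b‖²`. -/
abbrev Complexification (X : Type*) : Type _ := WithLp 2 (X × X)

/-- `Γ` extended to complex-valued functions: `Γ(f + i g) = Γ f + i Γ g`. -/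
def gammaOpC (C : X →L[ℝ] X) (U : X → ℝ) (f : X → ℂ) (x : X) : Complexification X :=
  WithLp.toLp 2 (gammaOp C U (fun z => (f z).re) x, gammaOp C U (fun z => (f z).im) x)

/-- The complex exponential `x ↦ e^{i⟨s, x⟩}`. -/
def cexpInner (s x : X) : ℂ := Complex.exp (Complex.I * (inner ℝ s x : ℝ))

/-- The kernel Stein discrepancy of `Q` with respect to a Stein operator `A` acting on the Hilbert
space `H_K` of functions with kernel `K = k I_V`: the supremum of `|E_Q[A f(X)]|` over the unit
ball of `H_K`, in `[0, ∞]`. -/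
def ksd [MeasurableSpace X] {V : Type*} [NormedAddCommGroup V] [InnerProductSpace ℝ V]
    [CompleteSpace V] (k : PDKernel X) (A : (X → V) → X → ℝ) (Q : Measure X) : ℝ≥0∞ :=
  ⨆ (f : HilbertRKHS k V) (_ : ‖f‖ ≤ 1), ENNReal.ofReal |∫ x, A f x ∂Q|

end Hilbert

end SpectralKSD

end

set_option linter.unusedSectionVars false

noncomputable section

universe u

/-! Everything takes place in `L²(μ; V_ℂ)`, with `V = ℝ` for the scalar Stein operator and `V = X`
for the vectorised one. Since `k(x, y) = ∫ cos⟨s, x - y⟩ dμ(s)`, sending the kernel section at `(x,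
v)` to `s ↦ e^{i⟨s, x⟩} v` preserves inner products. It extends to an isometry `J` of the RKHS into
`L²(μ; V_ℂ)`, and `f(x) = ∫ Re(e^{-i⟨s, x⟩} (Jf)(s)) dμ(s)` (`exists_spectral_isometry`).

Applying the Stein operator under this integral gives `A f(x) = ∫ ⟨(Jf)(s), Ψ(x, s)⟩ dμ(s)`, where
`Ψ(x, s)` is `𝒜(e^{i⟨s, ·⟩})(x)` or `Γ(e^{i⟨s, ·⟩})(x)` (`steinOp_transform`,
`vecSteinOp_transform`). Averaging over `Q` yields `E_Q[A f] = ⟨Jf, h⟩` with `h(s) = E_Q[Ψ(·, s)]`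
(`exists_Lp_mean`). The discrepancy is therefore the norm of the projection of `h` onto the range of
`J`. In fact `h` lies in that range: an element orthogonal to it has zero transform, and `⟨g, h⟩`
depends on `g` only through its transform. So the discrepancy is `‖h‖` (`ksd_eq_norm`), which is the
claimed integral.

The analytic difficulty is that in infinite dimension `∫ ‖s‖² dμ` may be infinite. The smoothness of
`k` only controls the weak moments `∫ ⟨s, v⟩^n dμ ≤ B ‖v‖^n`, with `n = 2` for `C_b^{(1,1)}` and `n
= 4` for `C_b^{(2,2)}`, and, through continuity of the top mixed derivative, the same moments
weighted by `1 - cos⟨s, t⟩` for small `t` (`HasWeakMoment`). By Cauchy–Schwarz this suffices for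
Fréchet differentiability of every transform of an `L²(μ)` function. The trace is handled by writing
`Tr[C T] = E_N⟨T z, z⟩`: weak moments at fixed `z`, combined with `E_N ‖z‖² < ∞`, justify every
exchange of integrals (`integrable_prod_of_sqrt_bound`). -/

namespace SpectralKSD

/-! ### Complex multiplication on the complexification, in real terms. -/

section Phase

variable {V : Type*} [NormedAddCommGroup V] [InnerProductSpace ℝ V]

/-- The real form of multiplication by `e^{-iθ}` followed by the real part:
`(a, b) ↦ cos θ a + sin θ b`. -/
def phase (θ : ℝ) : Complexification V →L[ℝ] V :=
  Real.cos θ • WithLp.fstL 2 ℝ V V + Real.sin θ • WithLp.sndL 2 ℝ V V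

theorem phase_apply (θ : ℝ) (w : Complexification V) :
    phase θ w = Real.cos θ • w.fst + Real.sin θ • w.snd := rfl

/-- The adjoint of `phase θ`. -/
def feature (θ : ℝ) (v : V) : Complexification V :=
  WithLp.toLp 2 (Real.cos θ • v, Real.sin θ • v)

theorem inner_feature (w : Complexification V) (θ : ℝ) (v : V) :
    inner ℝ w (feature θ v) = inner ℝ (phase θ w) v := by
  simp [feature, phase_apply, WithLp.prod_inner_apply, inner_add_left, inner_smul_left,
    inner_smul_right]

theorem inner_feature_feature (θ η : ℝ) (v w : V) :
    inner ℝ (feature θ v) (feature η w) = Real.cos (θ - η) * inner ℝ v w := by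
  rw [inner_feature, phase_apply, Real.cos_sub]
  simp only [feature, WithLp.toLp_fst, WithLp.toLp_snd, inner_add_left, inner_smul_left,
    RCLike.conj_to_real]
  ring

theorem norm_feature (θ : ℝ) (v : V) : ‖feature θ v‖ = ‖v‖ := by
  have h := inner_feature_feature θ θ v v
  rw [real_inner_self_eq_norm_sq, real_inner_self_eq_norm_sq, sub_self, Real.cos_zero, one_mul] at h
  exact (sq_eq_sq₀ (norm_nonneg _) (norm_nonneg _)).1 h

/-- `phase θ` is the adjoint of the isometry `feature θ`, hence a contraction. -/
theorem norm_phase_le (θ : ℝ) (w : Complexification V) : ‖phase θ w‖ ≤ ‖w‖ := by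
  have h : ‖phase θ w‖ * ‖phase θ w‖ ≤ ‖w‖ * ‖phase θ w‖ := by
    rw [← real_inner_self_eq_norm_mul_norm, ← inner_feature]
    exact (real_inner_le_norm _ _).trans_eq (by rw [norm_feature])
  rcases (norm_nonneg (phase θ w)).eq_or_lt with h0 | h0
  · exact h0 ▸ norm_nonneg _
  · exact le_of_mul_le_mul_right h h0

theorem norm_feature_sub_sq (θ η : ℝ) (v : V) :
    ‖feature θ v - feature η v‖ ^ 2 = 2 * (1 - Real.cos (θ - η)) * ‖v‖ ^ 2 := by
  rw [norm_sub_sq_real, norm_feature, norm_feature, inner_feature_feature,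
    real_inner_self_eq_norm_sq]
  ring

/-- The factor is `|e^{iθ} - e^{iη}|`, transferred by duality from `feature`. Kept in this exact
form, it later turns into the weight `1 - cos` under Cauchy–Schwarz. -/
theorem norm_phase_sub_le (θ η : ℝ) (w : Complexification V) :
    ‖phase θ w - phase η w‖ ≤ √(2 * (1 - Real.cos (θ - η))) * ‖w‖ := by
  set d := phase θ w - phase η w with hd
  have h : ‖d‖ * ‖d‖ ≤ (√(2 * (1 - Real.cos (θ - η))) * ‖w‖) * ‖d‖ := by
    have h1 : ‖d‖ * ‖d‖ = inner ℝ w (feature θ d - feature η d) := by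
      rw [inner_sub_right, inner_feature, inner_feature, ← inner_sub_left, ← hd,
        real_inner_self_eq_norm_mul_norm]
    have h2 : ‖feature θ d - feature η d‖ = √(2 * (1 - Real.cos (θ - η))) * ‖d‖ := by
      rw [← Real.sqrt_sq (norm_nonneg (feature θ d - feature η d)), norm_feature_sub_sq,
        Real.sqrt_mul (by linarith [Real.cos_le_one (θ - η)]), Real.sqrt_sq (norm_nonneg _)]
    rw [h1]
    refine (real_inner_le_norm _ _).trans_eq ?_
    rw [h2]; ring
  rcases (norm_nonneg d).eq_or_lt with h0 | h0
  · exact h0 ▸ by positivity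
  · exact le_of_mul_le_mul_right h h0

/-- Multiplication by `-i` on the complexification: `(a, b) ↦ (b, -a)`. -/
def quarterTurn : Complexification V →L[ℝ] Complexification V :=
  (WithLp.prodContinuousLinearEquiv 2 ℝ V V).symm.toContinuousLinearMap ∘L
    ((WithLp.sndL 2 ℝ V V).prod (-WithLp.fstL 2 ℝ V V))

@[simp] theorem quarterTurn_fst (w : Complexification V) : (quarterTurn w).fst = w.snd := rfl

@[simp] theorem quarterTurn_snd (w : Complexification V) : (quarterTurn w).snd = -w.fst := rfl

theorem quarterTurn_quarterTurn (w : Complexification V) : quarterTurn (quarterTurn w) = -w := by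
  apply WithLp.ofLp_injective
  ext <;> rfl

theorem norm_quarterTurn (w : Complexification V) : ‖quarterTurn w‖ = ‖w‖ := by
  rw [← sq_eq_sq₀ (norm_nonneg _) (norm_nonneg _), WithLp.prod_norm_sq_eq_of_L2,
    WithLp.prod_norm_sq_eq_of_L2]
  simp [add_comm]

/-- In complex notation, `Re(e^{-i(p + τm)} w)` has derivative `Re(e^{-i(p + τm)} (-i m w))`. -/
theorem hasDerivAt_phase (p m ρ : ℝ) (w : Complexification V) :
    HasDerivAt (fun τ => phase (p + τ * m) w) (phase (p + ρ * m) (m • quarterTurn w)) ρ := by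
  have h : HasDerivAt (fun τ : ℝ => p + τ * m) m ρ := by
    simpa using ((hasDerivAt_id ρ).mul_const m).const_add p
  convert! (h.cos.smul_const w.fst).add (h.sin.smul_const w.snd) using 1
  simp only [phase_apply, WithLp.smul_fst, WithLp.smul_snd, quarterTurn_fst, quarterTurn_snd,
    smul_neg, smul_smul]
  module

theorem continuous_phase : Continuous fun p : ℝ × Complexification V => phase p.1 p.2 := by
  simp only [phase_apply]
  fun_prop

theorem continuous_feature : Continuous fun p : ℝ × V => feature p.1 p.2 := by
  unfold feature
  fun_prop

end Phase

section Symbol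

variable {X : Type*} [NormedAddCommGroup X] [InnerProductSpace ℝ X]
  {V : Type*} [NormedAddCommGroup V] [InnerProductSpace ℝ V]

/-- The multiplier which corresponds to the derivative in direction `v`. -/
def derivSymbol (v : X) (g : X → Complexification V) (s : X) : Complexification V :=
  (inner ℝ s v : ℝ) • quarterTurn (g s)

theorem norm_derivSymbol (v : X) (g : X → Complexification V) (s : X) :
    ‖derivSymbol v g s‖ = |inner ℝ s v| * ‖g s‖ := by
  rw [derivSymbol, norm_smul, norm_quarterTurn, Real.norm_eq_abs]

end Symbol

/-! ### Vector-valued Fourier transforms and their derivatives along lines. -/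

section Transform

variable {X : Type*} [NormedAddCommGroup X] [InnerProductSpace ℝ X] [MeasurableSpace X]
  [BorelSpace X] {V : Type*} [NormedAddCommGroup V] [InnerProductSpace ℝ V]

/-- The real Fourier transform `x ↦ ∫ cos ⟨s, x⟩ a(s) + sin ⟨s, x⟩ b(s) dμ(s)` of `(a, b)`. -/
def transform (μ : Measure X) (g : X → Complexification V) (x : X) : V :=
  ∫ s, phase (inner ℝ s x) (g s) ∂μ

variable {μ : Measure X} {g : X → Complexification V}

theorem aestronglyMeasurable_inner (v : X) :
    AEStronglyMeasurable (fun s : X => (inner ℝ s v : ℝ)) μ :=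
  (by fun_prop : Continuous fun s : X => (inner ℝ s v : ℝ)).aestronglyMeasurable

theorem aestronglyMeasurable_phase (hg : AEStronglyMeasurable g μ) (x : X) :
    AEStronglyMeasurable (fun s => phase (inner ℝ s x) (g s)) μ :=
  continuous_phase.comp_aestronglyMeasurable (f := fun s => ((inner ℝ s x : ℝ), g s))
    ((aestronglyMeasurable_inner x).prodMk hg)

theorem integrable_phase (hg : Integrable g μ) (x : X) :
    Integrable (fun s => phase (inner ℝ s x) (g s)) μ :=
  hg.mono (aestronglyMeasurable_phase hg.1 x) (ae_of_all _ fun _ => norm_phase_le _ _)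

theorem aestronglyMeasurable_derivSymbol (hg : AEStronglyMeasurable g μ) (v : X) :
    AEStronglyMeasurable (derivSymbol v g) μ :=
  (aestronglyMeasurable_inner v).smul (quarterTurn.continuous.comp_aestronglyMeasurable hg)

theorem norm_transform_le (hg : Integrable g μ) (x : X) : ‖transform μ g x‖ ≤ ∫ s, ‖g s‖ ∂μ :=
  norm_integral_le_of_norm_le hg.norm (ae_of_all _ fun _ => norm_phase_le _ _)

/-- The bound depends on the increment `t` alone, so it gives uniform continuity estimates over all
base points. -/
theorem norm_transform_sub_le (hg : Integrable g μ) (x t : X) :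
    ‖transform μ g (x + t) - transform μ g x‖ ≤
      ∫ s, √(2 * (1 - Real.cos (inner ℝ s t))) * ‖g s‖ ∂μ := by
  rw [transform, transform, ← integral_sub (integrable_phase hg _) (integrable_phase hg _)]
  refine norm_integral_le_of_norm_le ?_ (ae_of_all _ fun s => ?_)
  · have hc : Continuous fun s : X => √(2 * (1 - Real.cos (inner ℝ s t))) := by fun_prop
    refine hg.norm.bdd_mul (c := 2) hc.aestronglyMeasurable (ae_of_all _ fun s => ?_)
    rw [Real.norm_of_nonneg (Real.sqrt_nonneg _)]
    refine Real.sqrt_le_iff.2 ⟨by norm_num, ?_⟩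
    linarith [Real.neg_one_le_cos (inner ℝ s t)]
  · refine (norm_phase_sub_le _ _ _).trans_eq ?_
    rw [inner_add_right, add_sub_cancel_left]

/-- Differentiation of the Fourier transform along a line. -/
theorem hasDerivAt_transform (hg : Integrable g μ) (v : X) (hgv : Integrable (derivSymbol v g) μ)
    (x : X) (ρ : ℝ) :
    HasDerivAt (fun τ : ℝ => transform μ g (x + τ • v)) (transform μ (derivSymbol v g) (x + ρ • v))
      ρ := by
  have h : ∀ s, ∀ τ : ℝ, HasDerivAt (fun τ : ℝ => phase (inner ℝ s (x + τ • v)) (g s))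
      (phase (inner ℝ s (x + τ • v)) (derivSymbol v g s)) τ := by
    intro s τ
    have h := hasDerivAt_phase (inner ℝ s x) (inner ℝ s v) τ (g s)
    have e : ∀ τ : ℝ, (inner ℝ s (x + τ • v) : ℝ) = inner ℝ s x + τ * inner ℝ s v := fun τ => by
      rw [inner_add_right, inner_smul_right]
    simp only [e]
    exact h
  have hb : ∀ s, ∀ τ : ℝ, ‖phase (inner ℝ s (x + τ • v)) (derivSymbol v g s)‖ ≤
      ‖derivSymbol v g s‖ := fun s τ => norm_phase_le _ _
  exact (hasDerivAt_integral_of_dominated_loc_of_deriv_le (x₀ := ρ) (s := Set.univ)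
    (F := fun (τ : ℝ) s => phase (inner ℝ s (x + τ • v)) (g s))
    (F' := fun (τ : ℝ) s => phase (inner ℝ s (x + τ • v)) (derivSymbol v g s))
    (bound := fun s => ‖derivSymbol v g s‖)
    univ_mem (Eventually.of_forall fun τ => aestronglyMeasurable_phase hg.1 (x + τ • v))
    (integrable_phase hg (x + ρ • v)) (aestronglyMeasurable_phase hgv.1 (x + ρ • v))
    (ae_of_all _ fun s τ _ => hb s τ) hgv.norm (ae_of_all _ fun s τ _ => h s τ)).2

end Transform

/-! ### The RKHS as a closed subspace of `L²(μ)`. -/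

section SpectralRKHS

variable {X : Type*} [NormedAddCommGroup X] [InnerProductSpace ℝ X] [MeasurableSpace X]
  [BorelSpace X] {V : Type*} [NormedAddCommGroup V] [InnerProductSpace ℝ V]

/-- As `k` is real, only the real part of the characteristic function contributes; no symmetrisation
of `μ` is needed. -/
theorem kernel_eq_integral_cos {k : PDKernel X} {μ : Measure X} [IsFiniteMeasure μ]
    (hk : ∀ x y : X, (k x y : ℂ) = charFun μ (x - y)) (x y : X) :
    k x y = ∫ s, Real.cos (inner ℝ s (x - y)) ∂μ := by
  have h := congrArg Complex.re (hk x y)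
  rw [Complex.ofReal_re, charFun_apply] at h
  rw [h]
  have hi : Integrable (fun s : X => Complex.exp ((inner ℝ s (x - y) : ℝ) * Complex.I)) μ := by
    refine .of_bound (C := 1) ?_ (ae_of_all _ fun s => ?_)
    · exact (by fun_prop : Continuous fun r : ℝ =>
        Complex.exp (r * Complex.I)).comp_aestronglyMeasurable (aestronglyMeasurable_inner _)
    · rw [Complex.norm_exp_ofReal_mul_I]
  rw [← Complex.reCLM_apply, ← Complex.reCLM.integral_comp_comm hi]
  simp [Complex.exp_ofReal_mul_I_re]

theorem memLp_feature (μ : Measure X) [IsFiniteMeasure μ] (x : X) (v : V) :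
    MemLp (fun s => feature (inner ℝ s x) v) 2 μ := by
  refine MemLp.of_bound ?_ ‖v‖ (ae_of_all _ fun s => (norm_feature _ v).le)
  exact continuous_feature.comp_aestronglyMeasurable (f := fun s => ((inner ℝ s x : ℝ), v))
    ((aestronglyMeasurable_inner x).prodMk aestronglyMeasurable_const)

/-- The spectral feature map. -/
def featureLp (μ : Measure X) [IsFiniteMeasure μ] (x : X) (v : V) :
    Lp (Complexification V) 2 μ := (memLp_feature μ x v).toLp _

theorem coeFn_featureLp (μ : Measure X) [IsFiniteMeasure μ] (x : X) (v : V) :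
    featureLp μ x v =ᵐ[μ] fun s => feature (inner ℝ s x) v := MemLp.coeFn_toLp _

theorem inner_featureLp_featureLp {k : PDKernel X} {μ : Measure X} [IsFiniteMeasure μ]
    (hk : ∀ x y : X, (k x y : ℂ) = charFun μ (x - y)) (x y : X) (v w : V) :
    inner ℝ (featureLp μ x v) (featureLp μ y w) = k x y * inner ℝ v w := by
  rw [L2.inner_def, kernel_eq_integral_cos hk, ← integral_mul_const]
  refine integral_congr_ae ?_
  filter_upwards [coeFn_featureLp μ x v, coeFn_featureLp μ y w] with s h1 h2
  rw [h1, h2, inner_feature_feature, inner_sub_right]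

variable [CompleteSpace V]

theorem inner_featureLp {μ : Measure X} [IsFiniteMeasure μ]
    (g : Lp (Complexification V) 2 μ) (x : X) (v : V) :
    inner ℝ g (featureLp μ x v) = inner ℝ (transform μ g x) v := by
  have hg : Integrable g μ := (Lp.memLp g).integrable (by norm_num)
  rw [L2.inner_def, transform, ← real_inner_comm, ← integral_inner (integrable_phase hg x)]
  refine integral_congr_ae ?_
  filter_upwards [coeFn_featureLp μ x v] with s h1
  rw [h1, inner_feature, real_inner_comm]

/-- The RKHS of a kernel with spectral measure `μ` embeds isometrically into `L²(μ)`, and its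
elements are the Fourier transforms of their images. -/
theorem exists_spectral_isometry {k : PDKernel X} {μ : Measure X} [IsFiniteMeasure μ]
    (hk : ∀ x y : X, (k x y : ℂ) = charFun μ (x - y)) :
    ∃ J : HilbertRKHS k V →ₗᵢ[ℝ] Lp (Complexification V) 2 μ,
      (∀ (f : HilbertRKHS k V) (x : X), f x = transform μ (J f) x) ∧
      ∀ (x : X) (v : V), J (RKHS.kerFun (HilbertRKHS k V) x v) = featureLp μ x v := by
  let e : (X × V →₀ ℝ) →ₗ[ℝ] HilbertRKHS k V :=
    Finsupp.linearCombination ℝ fun p => RKHS.kerFun (HilbertRKHS k V) p.1 p.2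
  let φ : (X × V →₀ ℝ) →ₗ[ℝ] Lp (Complexification V) 2 μ :=
    Finsupp.linearCombination ℝ fun p => featureLp μ p.1 p.2
  -- Both Gram matrices have entries `k(x, y) ⟨v, w⟩`, so formal combinations of kernel sections and
  -- of features have the same inner products.
  have hinner : ∀ c d, (inner ℝ (φ c) (φ d) : ℝ) = inner ℝ (e c) (e d) := by
    intro c d
    simp only [φ, e, Finsupp.linearCombination_apply, Finsupp.sum_inner, Finsupp.inner_sum,
      inner_featureLp_featureLp hk, inner_smul_left, inner_smul_right]
    refine Finset.sum_congr rfl fun p _ => congrArg (d p * ·)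
      (Finset.sum_congr rfl fun q _ => congrArg (c q * ·) ?_)
    rw [← RKHS.kernel_inner, RKHS.OfKernel.kernel_ofKernel]
    simp [PDKernel.op, inner_smul_left, k.symm' q.1 p.1]
  have hnorm : ∀ c, ‖φ c‖ = ‖e c‖ := fun c => by
    rw [← sq_eq_sq₀ (norm_nonneg _) (norm_nonneg _), ← real_inner_self_eq_norm_sq,
      ← real_inner_self_eq_norm_sq, hinner]
  have hdense : DenseRange e := by
    have h := RKHS.kerFun_dense (𝕜 := ℝ) (HilbertRKHS k V)
    have hr : Set.range e = (Submodule.span ℝ {RKHS.kerFun (HilbertRKHS k V) x v | (x) (v)} : 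
        Submodule ℝ (HilbertRKHS k V)) := by
      rw [← LinearMap.coe_range, Finsupp.range_linearCombination]
      congr 2
      ext f
      simp
    rw [DenseRange, hr, Submodule.dense_iff_topologicalClosure_eq_top]
    exact h
  have hbound : ∃ C, ∀ c, ‖φ c‖ ≤ C * ‖e c‖ := ⟨1, fun c => by rw [hnorm, one_mul]⟩
  -- The map `e` need not be injective; equality of norms makes `φ` factor through its dense range
  -- and extend by continuity.
  let J := φ.extendOfNorm e
  have hJ : ∀ c, J (e c) = φ c := fun c => LinearMap.extendOfNorm_eq hdense hbound c
  have hJnorm : ∀ f, ‖J f‖ = ‖f‖ := fun f => by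
    refine hdense.induction_on (p := fun f => ‖J f‖ = ‖f‖) f
      (isClosed_eq (by fun_prop) (by fun_prop)) fun c => ?_
    rw [hJ, hnorm]
  let Ji : HilbertRKHS k V →ₗᵢ[ℝ] Lp (Complexification V) 2 μ := ⟨J.toLinearMap, hJnorm⟩
  have hker : ∀ (x : X) (v : V),
      Ji (RKHS.kerFun (HilbertRKHS k V) x v) = featureLp μ x v := fun x v => by
    have := hJ (Finsupp.single (x, v) 1)
    simp only [e, φ, Finsupp.linearCombination_single, one_smul] at this
    exact this
  refine ⟨Ji, fun f x => ext_inner_right ℝ fun v => ?_, hker⟩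
  rw [← inner_featureLp, ← hker, Ji.inner_map_map, RKHS.inner_kerFun]

/-- If the expectation of `A f` is the inner product of the spectral representation of `f` with
`h`, then the kernel Stein discrepancy is the norm of `h`. -/
theorem ksd_eq_norm {k : PDKernel X} {μ : Measure X} [IsFiniteMeasure μ]
    (hk : ∀ x y : X, (k x y : ℂ) = charFun μ (x - y)) {A : (X → V) → X → ℝ} {Q : Measure X}
    {h : Lp (Complexification V) 2 μ}
    (hA : ∀ g : Lp (Complexification V) 2 μ, ∫ x, A (transform μ g) x ∂Q = inner ℝ g h) :
    ksd k A Q = ENNReal.ofReal ‖h‖ := by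
  obtain ⟨J, hJ, hker⟩ := exists_spectral_isometry (V := V) hk
  have hf : ∀ f : HilbertRKHS k V, ∫ x, A f x ∂Q = inner ℝ (J f) h := fun f => by
    rw [← hA]
    rw [show (f : X → V) = transform μ (J f) from funext (hJ f)]
  -- The range of an isometry on a complete space is closed, so it equals its double orthogonal
  -- complement. An element `g` orthogonal to it is orthogonal to all features and has zero
  -- transform. Since `hA` covers all of `L²(μ)`, not just the range, it follows that `⟨g, h⟩ = 0`.
  have hmem : h ∈ LinearMap.range J.toLinearMap := by
    have hcl : IsClosed (LinearMap.range J.toLinearMap : Set (Lp (Complexification V) 2 μ)) :=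
      J.isometry.isClosedEmbedding.isClosed_range
    have : CompleteSpace (LinearMap.range J.toLinearMap) := hcl.completeSpace_coe
    rw [← Submodule.orthogonal_orthogonal (LinearMap.range J.toLinearMap)]
    rw [Submodule.mem_orthogonal]
    intro g hg
    have hg0 : transform μ g = transform μ (0 : Lp (Complexification V) 2 μ) := by
      funext x
      refine ext_inner_right ℝ fun v => ?_
      rw [← inner_featureLp, ← inner_featureLp, inner_zero_left]
      rw [← hker]
      exact Submodule.inner_left_of_mem_orthogonal
        (LinearMap.mem_range_self J.toLinearMap (RKHS.kerFun (HilbertRKHS k V) x v)) hg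
    rw [← hA, hg0, hA, inner_zero_left]
  obtain ⟨f₀, rfl⟩ := hmem
  refine le_antisymm (iSup₂_le fun f hf1 => ENNReal.ofReal_le_ofReal ?_) ?_
  · rw [hf]
    refine (abs_real_inner_le_norm _ _).trans ?_
    rw [J.norm_map]
    exact mul_le_of_le_one_left (norm_nonneg _) hf1
  · rcases eq_or_ne f₀ 0 with rfl | h0
    · simp
    · have hn : ‖f₀‖ ≠ 0 := norm_ne_zero_iff.2 h0
      -- Equality in Cauchy–Schwarz: the supremum is attained at the normalised representer.
      refine le_iSup₂_of_le (‖f₀‖⁻¹ • f₀) ?_ (ENNReal.ofReal_le_ofReal ?_)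
      · rw [norm_smul, norm_inv, norm_norm, inv_mul_cancel₀ hn]
      · rw [hf, map_smul, inner_smul_left]
        refine le_trans (le_of_eq ?_) (le_abs_self _)
        change ‖J f₀‖ = _ * inner ℝ (J f₀) (J f₀)
        rw [real_inner_self_eq_norm_sq, J.norm_map]
        simp only [RCLike.conj_to_real]
        field_simp

end SpectralRKHS

/-! ### Weak moments of the spectral measure from derivatives of the kernel. -/

/-- If a cosine transform with a nonnegative weight is twice differentiable with bounded second
derivative, then the weight has a finite second moment. -/
theorem integrable_mul_sq_of_hasDerivAt {Ω : Type*} [MeasurableSpace Ω] {μ : Measure Ω}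
    {w m : Ω → ℝ} (hw0 : ∀ s, 0 ≤ w s) (hw : Integrable w μ) (hm : AEStronglyMeasurable m μ)
    {H' H'' : ℝ → ℝ} {B : ℝ}
    (h1 : ∀ ρ, HasDerivAt (fun ρ => ∫ s, w s * Real.cos (ρ * m s) ∂μ) (H' ρ) ρ)
    (h2 : ∀ ρ, HasDerivAt H' (H'' ρ) ρ) (hB : ∀ ρ, |H'' ρ| ≤ B) :
    Integrable (fun s => w s * m s ^ 2) μ := by
  set H : ℝ → ℝ := fun ρ => ∫ s, w s * Real.cos (ρ * m s) ∂μ with hH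
  have hmeas : ∀ ρ : ℝ, AEStronglyMeasurable (fun s => Real.cos (ρ * m s)) μ := fun ρ =>
    Real.continuous_cos.comp_aestronglyMeasurable (hm.const_mul ρ)
  have hint : ∀ ρ, Integrable (fun s => w s * Real.cos (ρ * m s)) μ := fun ρ =>
    hw.mul_bdd (hmeas ρ) (ae_of_all _ fun _ => Real.abs_cos_le_one _)
  have hmax : ∀ ρ, H ρ ≤ H 0 := fun ρ => by
    refine integral_mono (hint ρ) (hint 0) fun s => ?_
    simp only [zero_mul, Real.cos_zero, mul_one]
    exact mul_le_of_le_one_right (hw0 s) (Real.cos_le_one _)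
  -- With a nonnegative weight, `cos ≤ 1` makes `0` a global maximum. This removes the first-order
  -- term at `0`.
  have h0 : H' 0 = 0 := IsLocalMax.hasDerivAt_eq_zero (Eventually.of_forall hmax) (h1 0)
  have hB0 : 0 ≤ B := (abs_nonneg _).trans (hB 0)
  have hH' : ∀ ρ, |H' ρ| ≤ B * |ρ| := fun ρ => by
    have := Convex.norm_image_sub_le_of_norm_hasDerivWithin_le (C := B) (s := Set.univ)
      (fun x _ => (h2 x).hasDerivWithinAt) (fun x _ => hB x) convex_univ (Set.mem_univ 0)
      (Set.mem_univ ρ)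
    simpa [h0] using this
  -- Two mean value estimates replace Taylor's formula; losing the factor `1/2` is harmless.
  have hHρ : ∀ ρ, 0 < ρ → H 0 - H ρ ≤ B * ρ * ρ := fun ρ hρ => by
    have := norm_image_sub_le_of_norm_deriv_le_segment' (f := H) (C := B * ρ) (a := 0) (b := ρ)
      (fun x _ => (h1 x).hasDerivWithinAt) (fun x hx => by
        refine (hH' x).trans ?_
        rw [abs_of_nonneg hx.1]
        exact mul_le_mul_of_nonneg_left hx.2.le hB0) ρ (Set.right_mem_Icc.2 hρ.le)
    rw [sub_zero, Real.norm_eq_abs, abs_sub_comm] at this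
    exact (le_abs_self _).trans this
  set r : ℕ → ℝ := fun n => 1 / ((n : ℝ) + 1) with hr
  have hrpos : ∀ n, 0 < r n := fun n => by positivity
  -- From `cos x ≤ 1 - (2/π²) x²` on `|x| ≤ π`. For fixed `s` the argument `r n * m s` eventually
  -- lies in that interval, so the scaled difference quotients dominate `c w m²` and Fatou's lemma
  -- applies.
  set c : ℝ := 2 / Real.pi ^ 2 with hc
  have hcpos : 0 < c := by positivity
  let f : ℕ → Ω → ℝ≥0∞ := fun n s =>
    ENNReal.ofReal ((w s - w s * Real.cos (r n * m s)) / r n ^ 2)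
  have hfint : ∀ n, ∫⁻ s, f n s ∂μ ≤ ENNReal.ofReal B := fun n => by
    have hi : Integrable (fun s => (w s - w s * Real.cos (r n * m s)) / r n ^ 2) μ :=
      (hw.sub (hint _)).div_const _
    rw [← ofReal_integral_eq_lintegral_ofReal hi]
    · refine ENNReal.ofReal_le_ofReal ?_
      rw [integral_div, integral_sub hw (hint _), div_le_iff₀ (pow_pos (hrpos n) 2)]
      have := hHρ (r n) (hrpos n)
      simp only [hH, zero_mul, Real.cos_zero, mul_one] at this
      linarith
    · refine ae_of_all _ fun s => div_nonneg ?_ (sq_nonneg _)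
      exact sub_nonneg.2 (mul_le_of_le_one_right (hw0 s) (Real.cos_le_one _))
  have hlim : ∀ s, ENNReal.ofReal (c * (w s * m s ^ 2)) ≤ liminf (fun n => f n s) atTop := by
    intro s
    refine le_liminf_of_le (by isBoundedDefault) ?_
    have ht : Tendsto (fun n => r n * m s) atTop (𝓝 0) := by
      have := (tendsto_one_div_add_atTop_nhds_zero_nat (𝕜 := ℝ)).mul_const (m s)
      rwa [zero_mul] at this
    have ht' := ht.abs
    rw [abs_zero] at ht'
    filter_upwards [ht'.eventually_le_const Real.pi_pos] with n hn
    refine ENNReal.ofReal_le_ofReal ?_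
    rw [le_div_iff₀ (pow_pos (hrpos n) 2)]
    have h3 := mul_le_mul_of_nonneg_left (Real.cos_le_one_sub_mul_cos_sq hn) (hw0 s)
    rw [hc]
    linarith
  have hfm : ∀ n, AEMeasurable (f n) μ := fun n =>
    (((hw.1.sub (hw.1.mul (hmeas _))).aemeasurable).div_const _).ennreal_ofReal
  have hfin : ∫⁻ s, ENNReal.ofReal (c * (w s * m s ^ 2)) ∂μ ≤ ENNReal.ofReal B :=
    (lintegral_mono hlim).trans ((lintegral_liminf_le' hfm).trans
      (liminf_le_of_le (by isBoundedDefault) fun b hb => by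
        obtain ⟨n, hn⟩ := hb.exists
        exact hn.trans (hfint n)))
  have hi : Integrable (fun s => c * (w s * m s ^ 2)) μ := by
    refine ⟨(hw.1.mul (hm.pow 2)).const_mul c, ?_⟩
    rw [hasFiniteIntegral_iff_ofReal]
    · exact hfin.trans_lt ENNReal.ofReal_lt_top
    · exact ae_of_all _ fun s => mul_nonneg hcpos.le (mul_nonneg (hw0 s) (sq_nonneg _))
  simpa [hcpos.ne'] using hi.const_mul c⁻¹

theorem hasDerivAt_iteratedFDeriv_line {E F : Type*} [NormedAddCommGroup E] [NormedSpace ℝ E]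
    [NormedAddCommGroup F] [NormedSpace ℝ F] {G : E → F} {α n : ℕ} (hG : ContDiff ℝ α G)
    (hn : n < α) (x v : E) (σ : ℝ) :
    HasDerivAt (fun σ : ℝ => iteratedFDeriv ℝ n G (x + σ • v) fun _ => v)
      (iteratedFDeriv ℝ (n + 1) G (x + σ • v) fun _ => v) σ := by
  have h := (hG.differentiable_iteratedFDeriv (m := n) (by exact_mod_cast hn)
    (x + σ • v)).hasFDerivAt
  have hl : HasDerivAt (fun σ : ℝ => x + σ • v) v σ := by
    simpa using ((hasDerivAt_id σ).smul_const v).const_add x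
  have h2 := h.comp_hasDerivAt σ hl
  exact ((ContinuousMultilinearMap.apply ℝ (fun _ : Fin n => E) F
    (fun _ => v)).hasFDerivAt.comp_hasDerivAt σ h2)

section MixedDeriv

variable {X : Type*} [NormedAddCommGroup X] [NormedSpace ℝ X]

/-- The partial derivative `D₁^i D₂^j F(x, y)`, evaluated in direction `v` throughout. -/
def mixedDeriv (F : X → X → ℝ) (i j : ℕ) (v x y : X) : ℝ :=
  iteratedFDeriv ℝ i (fun x => iteratedFDeriv ℝ j (F x) y) x (fun _ => v) fun _ => v

variable {F : X → X → ℝ}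

theorem mixedDeriv_zero_left (j : ℕ) (v x y : X) :
    mixedDeriv F 0 j v x y = iteratedFDeriv ℝ j (F x) y fun _ => v := by
  simp [mixedDeriv]

theorem mixedDeriv_zero_zero (v x y : X) : mixedDeriv F 0 0 v x y = F x y := by
  simp [mixedDeriv]

theorem IsCb.hasDerivAt_mixedDeriv_left {α : ℕ} (hF : IsCb α F) {i j : ℕ} (hi : i < α)
    (hj : j ≤ α) (v x y : X) (σ : ℝ) :
    HasDerivAt (fun σ : ℝ => mixedDeriv F i j v (x + σ • v) y)
      (mixedDeriv F (i + 1) j v (x + σ • v) y) σ :=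
  (ContinuousMultilinearMap.apply ℝ (fun _ : Fin j => X) ℝ
    (fun _ => v)).hasFDerivAt.comp_hasDerivAt σ
      (hasDerivAt_iteratedFDeriv_line (hF.contDiff_fst j hj y) hi x v σ)

theorem IsCb.hasDerivAt_mixedDeriv_right {α : ℕ} (hF : IsCb α F) {j : ℕ} (hj : j < α)
    (v x y : X) (τ : ℝ) :
    HasDerivAt (fun τ : ℝ => mixedDeriv F 0 j v x (y + τ • v))
      (mixedDeriv F 0 (j + 1) v x (y + τ • v)) τ := by
  simp only [mixedDeriv_zero_left]
  exact hasDerivAt_iteratedFDeriv_line (hF.contDiff_snd x) hj y v τ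

theorem abs_apply_apply_le {i j : ℕ}
    (T : ContinuousMultilinearMap ℝ (fun _ : Fin i => X)
      (ContinuousMultilinearMap ℝ (fun _ : Fin j => X) ℝ)) (v : X) :
    |T (fun _ => v) fun _ => v| ≤ ‖T‖ * ‖v‖ ^ (i + j) := by
  have h1 := (T fun _ => v).le_opNorm fun _ => v
  have h2 := T.le_opNorm fun _ => v
  simp only [Finset.prod_const, Finset.card_univ, Fintype.card_fin, Real.norm_eq_abs] at h1 h2
  calc _ ≤ _ := h1
    _ ≤ ‖T‖ * ‖v‖ ^ i * ‖v‖ ^ j := by gcongr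
    _ = _ := by ring

theorem IsCb.exists_abs_mixedDeriv_le {α : ℕ} (hF : IsCb α F) : ∃ B, 0 ≤ B ∧ ∀ i ≤ α, ∀ j ≤ α,
    ∀ v x y, |mixedDeriv F i j v x y| ≤ B * ‖v‖ ^ (i + j) := by
  obtain ⟨B, hB⟩ := hF.bounded_mixed
  refine ⟨B, (norm_nonneg _).trans (hB 0 (Nat.zero_le _) 0 (Nat.zero_le _) 0 0),
    fun i hi j hj v x y => ?_⟩
  refine (abs_apply_apply_le _ v).trans ?_
  gcongr
  exact hB i hi j hj x y

theorem IsCb.mono {α β : ℕ} (hF : IsCb β F) (h : α ≤ β) : IsCb α F where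
  contDiff_snd x := (hF.contDiff_snd x).of_le (by exact_mod_cast h)
  contDiff_fst j hj y := (hF.contDiff_fst j (hj.trans h) y).of_le (by exact_mod_cast h)
  continuous_mixed i hi j hj := hF.continuous_mixed i (hi.trans h) j (hj.trans h)
  bounded_mixed := hF.bounded_mixed.imp fun _ hB i hi j hj => hB i (hi.trans h) j (hj.trans h)

end MixedDeriv

section Moments

variable {X : Type*} [NormedAddCommGroup X] [InnerProductSpace ℝ X] [MeasurableSpace X]

/-- The weak moments of (even) order `n` exist, are bounded, and the operator-valued Fourier
transform which they define is continuous at `0`. -/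
structure HasWeakMoment (μ : Measure X) (n : ℕ) : Prop where
  integrable : ∀ v, Integrable (fun s => (inner ℝ s v : ℝ) ^ n) μ
  bound : ∃ B, 0 ≤ B ∧ ∀ v, ∫ s, (inner ℝ s v : ℝ) ^ n ∂μ ≤ B * ‖v‖ ^ n
  small : ∀ ε > 0, ∀ᶠ t in 𝓝 (0 : X), ∀ v,
    ∫ s, (inner ℝ s v : ℝ) ^ n * (1 - Real.cos (inner ℝ s t)) ∂μ ≤ ε * ‖v‖ ^ n

variable [BorelSpace X] {μ : Measure X} [IsFiniteMeasure μ]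

theorem integrable_inner_pow_of_le {m n : ℕ} (hn : Even n) (hmn : m ≤ n) {v : X}
    (h : Integrable (fun s => (inner ℝ s v : ℝ) ^ n) μ) :
    Integrable (fun s => (inner ℝ s v : ℝ) ^ m) μ := by
  refine ((integrable_const (1 : ℝ)).add h).mono ((aestronglyMeasurable_inner v).pow m)
    (ae_of_all _ fun s => ?_)
  have h0 : 0 ≤ (inner ℝ s v : ℝ) ^ n := hn.pow_nonneg _
  simp only [Pi.add_apply]
  rw [norm_pow, Real.norm_eq_abs, Real.norm_of_nonneg (by positivity), ← hn.pow_abs]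
  rcases le_total |(inner ℝ s v : ℝ)| 1 with h1 | h1
  · exact (pow_le_one₀ (abs_nonneg _) h1).trans (le_add_of_nonneg_right (by positivity))
  · exact (pow_le_pow_right₀ h1 hmn).trans (le_add_of_nonneg_left zero_le_one)

/-- On the diagonal the mixed derivative is the moment itself, so its boundedness gives `bound`. Its
continuity in operator norm at the origin gives `small`, with one neighbourhood of `t` serving all
directions `v`. -/
theorem hasWeakMoment_of_mixedDeriv {F : X → X → ℝ} {α : ℕ} (hF : IsCb α F)
    (hint : ∀ v : X, Integrable (fun s => (inner ℝ s v : ℝ) ^ (α + α)) μ)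
    (hmix : ∀ v x y, mixedDeriv F α α v x y =
      ∫ s, (inner ℝ s v : ℝ) ^ (α + α) * Real.cos (inner ℝ s (x - y)) ∂μ) :
    HasWeakMoment μ (α + α) where
  integrable := hint
  bound := by
    obtain ⟨B, hB0, hB⟩ := hF.exists_abs_mixedDeriv_le
    refine ⟨B, hB0, fun v => ?_⟩
    have h := (le_abs_self _).trans (hB α le_rfl α le_rfl v 0 0)
    simpa [hmix] using h
  small ε hε := by
    set D : X → _ := fun t => iteratedFDeriv ℝ α (fun x => iteratedFDeriv ℝ α (F x) 0) t with hD
    have hc : Continuous D :=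
      (hF.continuous_mixed α le_rfl α le_rfl).comp (continuous_id.prodMk continuous_const)
    have hcd : Tendsto (fun t => ‖D 0 - D t‖) (𝓝 0) (𝓝 0) := by
      simpa using ((continuous_const (y := D 0)).sub hc).norm.tendsto 0
    filter_upwards [hcd.eventually_le_const hε] with t ht v
    have hcos : ∀ t : X, Integrable
        (fun s => (inner ℝ s v : ℝ) ^ (α + α) * Real.cos (inner ℝ s t)) μ := fun t =>
      (hint v).mul_bdd (Real.continuous_cos.comp_aestronglyMeasurable
        (aestronglyMeasurable_inner t)) (ae_of_all _ fun _ => Real.abs_cos_le_one _)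
    have h1 : ∫ s, (inner ℝ s v : ℝ) ^ (α + α) * (1 - Real.cos (inner ℝ s t)) ∂μ =
        (D 0 - D t) (fun _ => v) (fun _ => v) := by
      have e0 : D 0 (fun _ => v) (fun _ => v) = _ := hmix v 0 0
      have et : D t (fun _ => v) (fun _ => v) = _ := hmix v t 0
      rw [sub_apply, sub_apply, e0, et,
        ← integral_sub (hcos _) (hcos _)]
      refine integral_congr_ae (ae_of_all _ fun s => ?_)
      simp [mul_sub]
    rw [h1]
    refine (le_abs_self _).trans ((abs_apply_apply_le _ v).trans ?_)
    gcongr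

/-- The transform of `s ↦ ⟨s, v⟩^j c`. -/
def monomialTransform (μ : Measure X) (j : ℕ) (v : X) (c : Complexification ℝ) (x : X) : ℝ :=
  transform μ (fun s => (inner ℝ s v : ℝ) ^ j • c) x

theorem monomialTransform_one (j : ℕ) (v x : X) :
    monomialTransform μ j v (WithLp.toLp 2 (1, 0)) x =
      ∫ s, (inner ℝ s v : ℝ) ^ j * Real.cos (inner ℝ s x) ∂μ := by
  refine integral_congr_ae (ae_of_all _ fun s => ?_)
  simp [phase_apply, mul_comm]

theorem monomialTransform_neg (j : ℕ) (v : X) (c : Complexification ℝ) (x : X) :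
    monomialTransform μ j v (-c) x = -monomialTransform μ j v c x := by
  simp [monomialTransform, transform, integral_neg]

theorem hasDerivAt_monomialTransform {j : ℕ} {v : X}
    (h : Integrable (fun s => (inner ℝ s v : ℝ) ^ j) μ)
    (h' : Integrable (fun s => (inner ℝ s v : ℝ) ^ (j + 1)) μ) (c : Complexification ℝ) (x : X)
    (ρ : ℝ) :
    HasDerivAt (fun τ : ℝ => monomialTransform μ j v c (x + τ • v))
      (monomialTransform μ (j + 1) v (quarterTurn c) (x + ρ • v)) ρ := by
  have e : derivSymbol v (fun s => (inner ℝ s v : ℝ) ^ j • c) =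
      fun s => (inner ℝ s v : ℝ) ^ (j + 1) • quarterTurn c := by
    funext s
    rw [derivSymbol, map_smul, smul_smul, pow_succ']
  have := hasDerivAt_transform (h.smul_const c) v (by rw [e]; exact h'.smul_const _) x ρ
  rwa [e] at this

/-- Derivative along the reflected line. -/
theorem hasDerivAt_monomialTransform_sub {j : ℕ} {v : X}
    (h : Integrable (fun s => (inner ℝ s v : ℝ) ^ j) μ)
    (h' : Integrable (fun s => (inner ℝ s v : ℝ) ^ (j + 1)) μ) (c : Complexification ℝ) (x y : X) :
    HasDerivAt (fun τ : ℝ => monomialTransform μ j v c (x - (y + τ • v)))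
      (-monomialTransform μ (j + 1) v (quarterTurn c) (x - y)) 0 := by
  -- The base point is written `-0` so that it matches the value of the reflection `τ ↦ -τ` at `0`
  -- in the chain rule.
  have h1 := hasDerivAt_monomialTransform h h' c (x - y) (-0)
  have h2 := HasDerivAt.scomp (0 : ℝ) h1 (hasDerivAt_neg (0 : ℝ))
  convert! h2 using 1
  · funext τ
    simp only [Function.comp_apply, neg_smul]
    congr 1
    abel
  · simp

theorem hasDerivAt_monomialTransform_add {j : ℕ} {v : X}
    (h : Integrable (fun s => (inner ℝ s v : ℝ) ^ j) μ)
    (h' : Integrable (fun s => (inner ℝ s v : ℝ) ^ (j + 1)) μ) (c : Complexification ℝ) (x y : X) :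
    HasDerivAt (fun τ : ℝ => monomialTransform μ j v c (x + τ • v - y))
      (monomialTransform μ (j + 1) v (quarterTurn c) (x - y)) 0 := by
  have h1 := hasDerivAt_monomialTransform h h' c (x - y) 0
  convert! h1 using 1
  · funext τ
    congr 1
    abel
  · simp

end Moments

section KernelMoments

variable {X : Type*} [NormedAddCommGroup X] [InnerProductSpace ℝ X] [MeasurableSpace X]
  [BorelSpace X] {μ : Measure X} [IsFiniteMeasure μ] {k : PDKernel X}
  (hk : ∀ x y : X, (k x y : ℂ) = charFun μ (x - y))
include hk

theorem kernel_eq_monomialTransform (v x y : X) :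
    k x y = monomialTransform μ 0 v (WithLp.toLp 2 (1, 0)) (x - y) := by
  rw [monomialTransform_one, kernel_eq_integral_cos hk]
  simp

/-- `C_b^{(1,1)}` supplies `D₁D₂k` but no pure second derivative. Translation invariance turns the
second derivative of `ρ ↦ k(0, ρv)` into `-D₁D₂k`, which is bounded, so the cosine transform of
weight `1` satisfies the moment criterion. -/
theorem integrable_inner_sq_of_isCb (hk1 : IsCb 1 k) (v : X) :
    Integrable (fun s => (inner ℝ s v : ℝ) ^ 2) μ := by
  obtain ⟨B, -, hB⟩ := hk1.exists_abs_mixedDeriv_le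
  have htr : ∀ y, mixedDeriv k 0 1 v 0 y = mixedDeriv k 0 1 v (-y) 0 := fun y => by
    have h1 := hk1.hasDerivAt_mixedDeriv_right (j := 0) one_pos v 0 y 0
    have h2 := hk1.hasDerivAt_mixedDeriv_right (j := 0) one_pos v (-y) 0 0
    simp only [mixedDeriv_zero_zero, zero_smul, add_zero, zero_add] at h1 h2
    refine h1.unique (h2.congr_of_eventuallyEq (Eventually.of_forall fun τ => ?_))
    simp only [kernel_eq_integral_cos hk]
    congr 3
    funext s
    rw [zero_sub, neg_add', sub_eq_add_neg]
  have h := integrable_mul_sq_of_hasDerivAt (μ := μ) (w := fun _ => 1)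
    (m := fun s : X => (inner ℝ s v : ℝ)) (H' := fun ρ => mixedDeriv k 0 1 v 0 (0 + ρ • v))
    (H'' := fun ρ => -mixedDeriv k 1 1 v (0 + (-ρ) • v) 0) (B := B * ‖v‖ ^ (1 + 1))
    (fun _ => zero_le_one) (integrable_const 1) (aestronglyMeasurable_inner v)
    (fun ρ => ?_) (fun ρ => ?_) fun ρ => ?_
  · simpa using h
  · have h1 := hk1.hasDerivAt_mixedDeriv_right (j := 0) one_pos v 0 0 ρ
    convert! h1 using 1
    funext τ
    rw [mixedDeriv_zero_zero, kernel_eq_integral_cos hk]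
    simp [inner_smul_right]
  · have h1 := hk1.hasDerivAt_mixedDeriv_left (i := 0) one_pos le_rfl v 0 0 (-ρ)
    have h2 := HasDerivAt.scomp ρ h1 (hasDerivAt_neg ρ)
    convert! h2 using 1
    · funext τ
      rw [htr]
      simp
    · simp
  · rw [abs_neg]
    exact hB 1 le_rfl 1 le_rfl v _ _

/-- This and the following formulas climb one derivative at a time: `k` is differentiated once as a
kernel and once under the integral, and uniqueness of derivatives identifies the results. Each pair
of steps contributes a double quarter turn, that is, a sign. -/
theorem mixedDeriv_zero_one (hk1 : IsCb 1 k) (v x y : X) : mixedDeriv k 0 1 v x y =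
    -monomialTransform μ 1 v (quarterTurn (WithLp.toLp 2 (1, 0))) (x - y) := by
  have hi := integrable_inner_sq_of_isCb hk hk1 v
  have h1 := hk1.hasDerivAt_mixedDeriv_right (j := 0) one_pos v x y 0
  simp only [mixedDeriv_zero_zero, zero_smul, add_zero, zero_add,
    kernel_eq_monomialTransform hk v] at h1
  exact h1.unique (hasDerivAt_monomialTransform_sub (integrable_inner_pow_of_le even_two
    (Nat.zero_le 2) hi) (integrable_inner_pow_of_le even_two one_le_two hi) _ x y)

theorem mixedDeriv_one_one (hk1 : IsCb 1 k) (v x y : X) : mixedDeriv k 1 1 v x y =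
    monomialTransform μ 2 v (WithLp.toLp 2 (1, 0)) (x - y) := by
  have hi := integrable_inner_sq_of_isCb hk hk1 v
  have h1 := hk1.hasDerivAt_mixedDeriv_left (i := 0) one_pos le_rfl v x y 0
  simp only [mixedDeriv_zero_one hk hk1, zero_smul, add_zero, zero_add] at h1
  have h2 := (hasDerivAt_monomialTransform_add (integrable_inner_pow_of_le even_two
    one_le_two hi) hi (quarterTurn (WithLp.toLp 2 (1, 0))) x y).neg
  rw [quarterTurn_quarterTurn, monomialTransform_neg, neg_neg] at h2
  exact h1.unique h2

theorem hasWeakMoment_two (hk1 : IsCb 1 k) : HasWeakMoment μ 2 :=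
  hasWeakMoment_of_mixedDeriv hk1 (integrable_inner_sq_of_isCb hk hk1) fun v x y => by
    rw [mixedDeriv_one_one hk hk1, monomialTransform_one]

theorem mixedDeriv_zero_two (hk2 : IsCb 2 k) (v x y : X) : mixedDeriv k 0 2 v x y =
    -monomialTransform μ 2 v (WithLp.toLp 2 (1, 0)) (x - y) := by
  have hk1 := hk2.mono one_le_two
  have hi := integrable_inner_sq_of_isCb hk hk1 v
  have h1 := hk2.hasDerivAt_mixedDeriv_right (j := 1) one_lt_two v x y 0
  simp only [mixedDeriv_zero_one hk hk1, zero_smul, add_zero] at h1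
  have h2 := (hasDerivAt_monomialTransform_sub (integrable_inner_pow_of_le even_two
    one_le_two hi) hi (quarterTurn (WithLp.toLp 2 (1, 0))) x y).neg
  rw [quarterTurn_quarterTurn, monomialTransform_neg, neg_neg] at h2
  exact h1.unique h2

/-- The moment criterion is applied again, now with weight `⟨s, v⟩²`. Its cosine transform along `v`
is `-D₂²k(ρv, 0)`, whose second derivative `-D₁²D₂²k` is bounded. -/
theorem integrable_inner_pow_four_of_isCb (hk2 : IsCb 2 k) (v : X) :
    Integrable (fun s => (inner ℝ s v : ℝ) ^ 4) μ := by
  obtain ⟨B, -, hB⟩ := hk2.exists_abs_mixedDeriv_le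
  have h := integrable_mul_sq_of_hasDerivAt (μ := μ) (w := fun s : X => (inner ℝ s v : ℝ) ^ 2)
    (m := fun s : X => (inner ℝ s v : ℝ)) (H' := fun ρ => -mixedDeriv k 1 2 v (0 + ρ • v) 0)
    (H'' := fun ρ => -mixedDeriv k 2 2 v (0 + ρ • v) 0) (B := B * ‖v‖ ^ (2 + 2))
    (fun _ => sq_nonneg _) (integrable_inner_sq_of_isCb hk (hk2.mono one_le_two) v)
    (aestronglyMeasurable_inner v) (fun ρ => ?_)
    (fun ρ => (hk2.hasDerivAt_mixedDeriv_left one_lt_two le_rfl v 0 0 ρ).neg) fun ρ => ?_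
  · exact h.congr (ae_of_all _ fun s => by ring)
  · convert! (hk2.hasDerivAt_mixedDeriv_left (i := 0) two_pos le_rfl v 0 0 ρ).neg using 1
    funext τ
    rw [Pi.neg_apply, mixedDeriv_zero_two hk hk2, neg_neg, monomialTransform_one]
    simp [inner_smul_right]
  · rw [abs_neg]
    exact hB 2 le_rfl 2 le_rfl v _ _

theorem mixedDeriv_two_two (hk2 : IsCb 2 k) (v x y : X) : mixedDeriv k 2 2 v x y =
    monomialTransform μ 4 v (WithLp.toLp 2 (1, 0)) (x - y) := by
  have h4 := integrable_inner_pow_four_of_isCb hk hk2 v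
  have he : Even 4 := ⟨2, rfl⟩
  have h3 := integrable_inner_pow_of_le he (by norm_num : 3 ≤ 4) h4
  have h2 := integrable_inner_pow_of_le he (by norm_num : 2 ≤ 4) h4
  have h12 : ∀ x, mixedDeriv k 1 2 v x y =
      -monomialTransform μ 3 v (quarterTurn (WithLp.toLp 2 (1, 0))) (x - y) := fun x => by
    have h1 := hk2.hasDerivAt_mixedDeriv_left (i := 0) two_pos le_rfl v x y 0
    simp only [mixedDeriv_zero_two hk hk2, zero_smul, add_zero, zero_add] at h1
    exact h1.unique (hasDerivAt_monomialTransform_add h2 h3 _ x y).neg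
  have h1 := hk2.hasDerivAt_mixedDeriv_left (i := 1) one_lt_two le_rfl v x y 0
  simp only [h12, zero_smul, add_zero] at h1
  have h5 := (hasDerivAt_monomialTransform_add h3 h4
    (quarterTurn (WithLp.toLp 2 (1, 0))) x y).neg
  rw [quarterTurn_quarterTurn, monomialTransform_neg, neg_neg] at h5
  exact h1.unique h5

theorem hasWeakMoment_four (hk2 : IsCb 2 k) : HasWeakMoment μ 4 :=
  hasWeakMoment_of_mixedDeriv hk2 (integrable_inner_pow_four_of_isCb hk hk2) fun v x y => by
    rw [mixedDeriv_two_two hk hk2, monomialTransform_one]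

end KernelMoments

/-! ### Fréchet differentiability of transforms of `L²(μ)` functions. -/

theorem norm_Lp_two_sq {Ω E : Type*} [MeasurableSpace Ω] {μ : Measure Ω} [NormedAddCommGroup E]
    [InnerProductSpace ℝ E] (g : Lp E 2 μ) : ‖g‖ ^ 2 = ∫ s, ‖g s‖ ^ 2 ∂μ := by
  rw [← real_inner_self_eq_norm_sq, L2.inner_def]
  simp only [real_inner_self_eq_norm_sq]

/-- The Cauchy–Schwarz inequality. -/
theorem integral_abs_mul_norm_le {Ω E : Type*} [MeasurableSpace Ω] {μ : Measure Ω}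
    [NormedAddCommGroup E] [InnerProductSpace ℝ E] {q : Ω → ℝ} (hq : MemLp q 2 μ) (g : Lp E 2 μ) :
    Integrable (fun s => |q s| * ‖g s‖) μ ∧
      ∫ s, |q s| * ‖g s‖ ∂μ ≤ √(∫ s, q s ^ 2 ∂μ) * ‖g‖ := by
  have hg : MemLp (fun s => ‖g s‖) 2 μ := (Lp.memLp g).norm
  have hq' : MemLp (fun s => |q s|) 2 μ := hq.abs
  refine ⟨hq'.integrable_mul hg, ?_⟩
  have h := real_inner_le_norm (hq'.toLp _) (hg.toLp _)
  have e1 : (inner ℝ (hq'.toLp _) (hg.toLp _) : ℝ) = ∫ s, |q s| * ‖g s‖ ∂μ := by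
    rw [L2.inner_def]
    refine integral_congr_ae ?_
    filter_upwards [hq'.coeFn_toLp, hg.coeFn_toLp] with s h1 h2
    rw [h1, h2]
    simp [mul_comm]
  have e2 : ‖hq'.toLp _‖ = √(∫ s, q s ^ 2 ∂μ) := by
    rw [← Real.sqrt_sq (norm_nonneg (hq'.toLp _)), norm_Lp_two_sq]
    congr 1
    refine integral_congr_ae ?_
    filter_upwards [hq'.coeFn_toLp] with s h1
    simp [h1]
  have e3 : ‖hg.toLp _‖ = ‖g‖ := by
    rw [← sq_eq_sq₀ (norm_nonneg _) (norm_nonneg _), norm_Lp_two_sq, norm_Lp_two_sq]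
    refine integral_congr_ae ?_
    filter_upwards [hg.coeFn_toLp] with s h1
    simp [h1]
  rwa [e1, e2, e3] at h

/-- Mean value inequality after subtracting the linear part. It upgrades directional derivatives to
Fréchet ones once `φ` oscillates little along the segment. -/
theorem norm_sub_sub_le_of_hasDerivAt_line {E F : Type*} [NormedAddCommGroup E] [NormedSpace ℝ E]
    [NormedAddCommGroup F] [NormedSpace ℝ F] {f φ : E → F} {x w : E} {c : ℝ}
    (h : ∀ τ : ℝ, HasDerivAt (fun τ : ℝ => f (x + τ • w)) (φ (x + τ • w)) τ)
    (hc : ∀ τ ∈ Set.Icc (0 : ℝ) 1, ‖φ (x + τ • w) - φ x‖ ≤ c) :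
    ‖f (x + w) - f x - φ x‖ ≤ c := by
  have hd : ∀ τ : ℝ, HasDerivAt (fun τ : ℝ => f (x + τ • w) - τ • φ x)
      (φ (x + τ • w) - φ x) τ := fun τ => by
    have := (h τ).sub ((hasDerivAt_id τ).smul_const (φ x))
    rw [one_smul] at this
    exact this
  have := norm_image_sub_le_of_norm_deriv_le_segment_01'
    (fun τ _ => (hd τ).hasDerivWithinAt) fun τ hτ => hc τ (Set.Ico_subset_Icc_self hτ)
  simpa [sub_right_comm] using this

section Regularity

variable {X : Type*} [NormedAddCommGroup X] [InnerProductSpace ℝ X] [MeasurableSpace X]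
  [BorelSpace X] {V : Type*} [NormedAddCommGroup V] [InnerProductSpace ℝ V]
  {μ : Measure X}

theorem integrable_sq_mul_one_sub_cos {q : X → ℝ} (hq : MemLp q 2 μ) (t : X) :
    Integrable (fun s => q s ^ 2 * (1 - Real.cos (inner ℝ s t))) μ := by
  refine hq.integrable_sq.mul_bdd (c := 2) ?_ (ae_of_all _ fun s => ?_)
  · exact (by fun_prop : Continuous fun r : ℝ => 1 - Real.cos r).comp_aestronglyMeasurable
      (aestronglyMeasurable_inner t)
  · rw [Real.norm_of_nonneg (by linarith [Real.cos_le_one (inner ℝ s t)])]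
    linarith [Real.neg_one_le_cos (inner ℝ s t)]

/-- Cauchy–Schwarz pairs `g` with the multiplier `q`, or with `q` times `√(2(1 - cos))` for
increments. Moments of `q` thus control the transform even when `q` is unbounded. -/
theorem transform_bounds {q : X → ℝ} (hq : MemLp q 2 μ) (g : Lp (Complexification V) 2 μ)
    {h : X → Complexification V} (hm : AEStronglyMeasurable h μ)
    (hn : ∀ s, ‖h s‖ = |q s| * ‖g s‖) :
    Integrable h μ ∧ (∀ x, ‖transform μ h x‖ ≤ √(∫ s, q s ^ 2 ∂μ) * ‖g‖) ∧
      ∀ x t, ‖transform μ h (x + t) - transform μ h x‖ ≤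
        √(2 * ∫ s, q s ^ 2 * (1 - Real.cos (inner ℝ s t)) ∂μ) * ‖g‖ := by
  obtain ⟨h1, h2⟩ := integral_abs_mul_norm_le hq g
  have hi : Integrable h μ := h1.mono' hm (ae_of_all _ fun s => (hn s).le)
  refine ⟨hi, fun x => ?_, fun x t => ?_⟩
  · refine (norm_transform_le hi x).trans ?_
    simpa only [hn] using h2
  · refine (norm_transform_sub_le hi x t).trans ?_
    have hpos : ∀ s, 0 ≤ 2 * (1 - Real.cos (inner ℝ s t)) := fun s => by
      linarith [Real.cos_le_one (inner ℝ s t)]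
    set q' : X → ℝ := fun s => √(2 * (1 - Real.cos (inner ℝ s t))) * q s with hq'
    have hsq : ∀ s, q' s ^ 2 = 2 * (q s ^ 2 * (1 - Real.cos (inner ℝ s t))) := fun s => by
      rw [hq', mul_pow, Real.sq_sqrt (hpos s)]
      ring
    have hm' : AEStronglyMeasurable q' μ :=
      ((by fun_prop : Continuous fun r : ℝ => √(2 * (1 - Real.cos r))).comp_aestronglyMeasurable
        (aestronglyMeasurable_inner t)).mul hq.1
    have hq2 : MemLp q' 2 μ := by
      rw [memLp_two_iff_integrable_sq hm']
      simp only [hsq]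
      exact (integrable_sq_mul_one_sub_cos hq t).const_mul 2
    have h3 := (integral_abs_mul_norm_le hq2 g).2
    simp only [hsq, integral_const_mul] at h3
    refine le_trans (le_of_eq (integral_congr_ae (ae_of_all _ fun s => ?_))) h3
    simp only [hq', hn, abs_mul, abs_of_nonneg (Real.sqrt_nonneg _), mul_assoc]

theorem derivSymbol_add (v v' : X) (g : X → Complexification V) (s : X) :
    derivSymbol (v + v') g s = derivSymbol v g s + derivSymbol v' g s := by
  simp only [derivSymbol, inner_add_right, add_smul]

theorem derivSymbol_smul (c : ℝ) (v : X) (g : X → Complexification V) (s : X) :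
    derivSymbol (c • v) g s = c • derivSymbol v g s := by
  simp only [derivSymbol, inner_smul_right, mul_smul]

theorem transform_add {g h : X → Complexification V} (hg : Integrable g μ) (hh : Integrable h μ)
    (x : X) : transform μ (fun s => g s + h s) x = transform μ g x + transform μ h x := by
  simp only [transform, map_add]
  exact integral_add (integrable_phase hg x) (integrable_phase hh x)

theorem transform_smul (c : ℝ) (g : X → Complexification V) (x : X) :
    transform μ (fun s => c • g s) x = c • transform μ g x := by
  simp only [transform, map_smul]
  exact integral_smul c _

namespace HasWeakMoment

theorem memLp_inner (hM : HasWeakMoment μ 2) (v : X) :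
    MemLp (fun s => (inner ℝ s v : ℝ)) 2 μ :=
  (memLp_two_iff_integrable_sq (aestronglyMeasurable_inner v)).2 (hM.integrable v)

theorem derivSymbol_bounds (hM : HasWeakMoment μ 2) (g : Lp (Complexification V) 2 μ) (v : X) :
    Integrable (derivSymbol v g) μ ∧
      (∀ x, ‖transform μ (derivSymbol v g) x‖ ≤ √(∫ s, (inner ℝ s v : ℝ) ^ 2 ∂μ) * ‖g‖) ∧
      ∀ x t, ‖transform μ (derivSymbol v g) (x + t) - transform μ (derivSymbol v g) x‖ ≤
        √(2 * ∫ s, (inner ℝ s v : ℝ) ^ 2 * (1 - Real.cos (inner ℝ s t)) ∂μ) * ‖g‖ :=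
  transform_bounds (hM.memLp_inner v) g
    (aestronglyMeasurable_derivSymbol (Lp.aestronglyMeasurable g) v) fun s => norm_derivSymbol v g s

theorem exists_sqrt_bound (hM : HasWeakMoment μ 2) : ∃ B, 0 ≤ B ∧ ∀ v : X,
    √(∫ s, (inner ℝ s v : ℝ) ^ 2 ∂μ) ≤ B * ‖v‖ := by
  obtain ⟨B, hB0, hB⟩ := hM.bound
  refine ⟨√B, Real.sqrt_nonneg _, fun v => ?_⟩
  refine (Real.sqrt_le_sqrt (hB v)).trans_eq ?_
  rw [Real.sqrt_mul hB0, Real.sqrt_sq (norm_nonneg _)]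

/-- The candidate derivative is bounded by the weak moment bound. The remainder is `o(‖w‖)` because
the weighted moments are small uniformly in the direction, which pointwise dominated convergence
alone would not provide. -/
theorem exists_fderiv_transform (hM : HasWeakMoment μ 2) [IsFiniteMeasure μ]
    (g : Lp (Complexification V) 2 μ) :
    ∃ T : X → X →L[ℝ] V, (∀ x v, T x v = transform μ (derivSymbol v g) x) ∧
      ∀ x, HasFDerivAt (transform μ g) (T x) x := by
  obtain ⟨B, hB0, hB⟩ := hM.exists_sqrt_bound
  let T : X → X →L[ℝ] V := fun x => LinearMap.mkContinuous
    { toFun := fun v => transform μ (derivSymbol v g) x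
      map_add' := fun v v' => by
        rw [← transform_add (hM.derivSymbol_bounds g v).1 (hM.derivSymbol_bounds g v').1]
        congr 1
        exact funext fun s => derivSymbol_add v v' g s
      map_smul' := fun c v => by
        rw [RingHom.id_apply, ← transform_smul]
        congr 1
        exact funext fun s => derivSymbol_smul c v g s }
    (B * ‖g‖) fun v => by
      refine ((hM.derivSymbol_bounds g v).2.1 x).trans ?_
      calc _ ≤ B * ‖v‖ * ‖g‖ := by gcongr; exact hB v
        _ = _ := by ring
  refine ⟨T, fun _ _ => rfl, fun x => ?_⟩
  have hgi : Integrable g μ := (Lp.memLp g).integrable (by norm_num)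
  rw [hasFDerivAt_iff_isLittleO_nhds_zero, Asymptotics.isLittleO_iff]
  intro c hc
  obtain ⟨δ, hδ, h⟩ := Metric.eventually_nhds_iff.1
    -- The `/ 2` cancels the factor `2` under the square root of the increment bound; `‖g‖ + 1`
    -- avoids dividing by zero.
    (hM.small ((c / (‖g‖ + 1)) ^ 2 / 2) (by positivity))
  filter_upwards [Metric.ball_mem_nhds (0 : X) hδ] with w hw
  refine norm_sub_sub_le_of_hasDerivAt_line
    (φ := fun x => transform μ (derivSymbol w g) x)
    (fun τ => hasDerivAt_transform hgi w (hM.derivSymbol_bounds g w).1 x τ) fun τ hτ => ?_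
  refine ((hM.derivSymbol_bounds g w).2.2 x (τ • w)).trans ?_
  have hτw : dist (τ • w) 0 < δ := by
    rw [dist_zero_right, norm_smul, Real.norm_of_nonneg hτ.1]
    exact (mul_le_of_le_one_left (norm_nonneg _) hτ.2).trans_lt (by simpa using hw)
  have hs := h hτw w
  calc _ ≤ √((c / (‖g‖ + 1) * ‖w‖) ^ 2) * ‖g‖ := by
        gcongr
        linarith
    _ = c * ‖w‖ * (‖g‖ / (‖g‖ + 1)) := by
        rw [Real.sqrt_sq (by positivity)]
        ring
    _ ≤ c * ‖w‖ := mul_le_of_le_one_right (by positivity)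
        (div_le_one_of_le₀ (by linarith) (by positivity))

theorem memLp_inner_mul_inner (hM : HasWeakMoment μ 4) (v w : X) :
    MemLp (fun s => (inner ℝ s w : ℝ) * inner ℝ s v) 2 μ := by
  have hm := (aestronglyMeasurable_inner (μ := μ) w).mul (aestronglyMeasurable_inner v)
  refine (memLp_two_iff_integrable_sq hm).2 ?_
  refine ((hM.integrable w).add (hM.integrable v)).mono' (hm.pow 2) (ae_of_all _ fun s => ?_)
  simp only [Pi.add_apply]
  rw [Real.norm_of_nonneg (by positivity)]
  simp only [Pi.mul_apply, mul_pow]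
  nlinarith [sq_nonneg ((inner ℝ s w : ℝ) ^ 2 - (inner ℝ s v : ℝ) ^ 2),
    sq_nonneg ((inner ℝ s w : ℝ) ^ 2), sq_nonneg ((inner ℝ s v : ℝ) ^ 2)]

/-- Cauchy–Schwarz for mixed weak moments. -/
theorem integral_mul_sq_le {ρ : X → ℝ} (hρ : ∀ s, 0 ≤ ρ s) {ε : ℝ}
    (hi : ∀ v : X, Integrable (fun s => (inner ℝ s v : ℝ) ^ 4 * ρ s) μ)
    (h : ∀ v : X, ∫ s, (inner ℝ s v : ℝ) ^ 4 * ρ s ∂μ ≤ ε * ‖v‖ ^ 4) (v w : X) :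
    ∫ s, ((inner ℝ s w : ℝ) * inner ℝ s v) ^ 2 * ρ s ∂μ ≤ ε * (‖w‖ * ‖v‖) ^ 2 := by
  rcases eq_or_ne v 0 with rfl | hv
  · simp
  rcases eq_or_ne w 0 with rfl | hw
  · simp
  have hv' : 0 < ‖v‖ := norm_pos_iff.2 hv
  have hw' : 0 < ‖w‖ := norm_pos_iff.2 hw
  -- Weights for `x²y² ≤ a x⁴ + b y⁴`: they satisfy `ab = 1/4`, and each term contributes half of
  -- the target `ε (‖w‖ ‖v‖)²`.
  set a : ℝ := ‖v‖ ^ 2 / ‖w‖ ^ 2 / 2 with ha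
  set b : ℝ := ‖w‖ ^ 2 / ‖v‖ ^ 2 / 2 with hb
  have hab : a * b = 1 / 4 := by rw [ha, hb]; field_simp; norm_num
  have ha0 : 0 < a := by positivity
  have hb0 : 0 < b := by positivity
  calc _ ≤ ∫ s, (a * ((inner ℝ s w : ℝ) ^ 4 * ρ s) + b * ((inner ℝ s v : ℝ) ^ 4 * ρ s)) ∂μ := by
        refine integral_mono_of_nonneg (ae_of_all _ fun s => mul_nonneg (sq_nonneg _) (hρ s))
          (((hi w).const_mul a).add ((hi v).const_mul b)) (ae_of_all _ fun s => ?_)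
        have key : ((inner ℝ s w : ℝ) * inner ℝ s v) ^ 2 ≤
            a * (inner ℝ s w : ℝ) ^ 4 + b * (inner ℝ s v : ℝ) ^ 4 := by
          have h1 := sq_nonneg (2 * a * (inner ℝ s w : ℝ) ^ 2 - (inner ℝ s v : ℝ) ^ 2)
          have h2 : b = 1 / (4 * a) := by field_simp; linarith
          rw [h2, ← mul_le_mul_iff_right₀ (show 0 < 4 * a by positivity)]
          field_simp
          nlinarith
        have := mul_le_mul_of_nonneg_right key (hρ s)
        simp only
        linarith
    _ = a * ∫ s, (inner ℝ s w : ℝ) ^ 4 * ρ s ∂μ + b * ∫ s, (inner ℝ s v : ℝ) ^ 4 * ρ s ∂μ := by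
        rw [integral_add ((hi w).const_mul a) ((hi v).const_mul b), integral_const_mul,
          integral_const_mul]
    _ ≤ a * (ε * ‖w‖ ^ 4) + b * (ε * ‖v‖ ^ 4) := by
        gcongr
        · exact h w
        · exact h v
    _ = _ := by rw [ha, hb]; field_simp; ring

theorem derivSymbol_derivSymbol_bounds (hM : HasWeakMoment μ 4) (g : Lp (Complexification V) 2 μ)
    (v w : X) :
    Integrable (derivSymbol w (derivSymbol v g)) μ ∧
      (∀ x, ‖transform μ (derivSymbol w (derivSymbol v g)) x‖ ≤
        √(∫ s, ((inner ℝ s w : ℝ) * inner ℝ s v) ^ 2 ∂μ) * ‖g‖) ∧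
      ∀ x t, ‖transform μ (derivSymbol w (derivSymbol v g)) (x + t) -
          transform μ (derivSymbol w (derivSymbol v g)) x‖ ≤
        √(2 * ∫ s, ((inner ℝ s w : ℝ) * inner ℝ s v) ^ 2 * (1 - Real.cos (inner ℝ s t)) ∂μ) *
          ‖g‖ :=
  transform_bounds (hM.memLp_inner_mul_inner v w) g
    (aestronglyMeasurable_derivSymbol
      (aestronglyMeasurable_derivSymbol (Lp.aestronglyMeasurable g) v) w)
    fun s => by rw [norm_derivSymbol, norm_derivSymbol, abs_mul, mul_assoc]

theorem exists_sqrt_bound_mul (hM : HasWeakMoment μ 4) : ∃ B, 0 ≤ B ∧ ∀ v w : X,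
    √(∫ s, ((inner ℝ s w : ℝ) * inner ℝ s v) ^ 2 ∂μ) ≤ B * (‖w‖ * ‖v‖) := by
  obtain ⟨B, hB0, hB⟩ := hM.bound
  refine ⟨√B, Real.sqrt_nonneg _, fun v w => ?_⟩
  have h := integral_mul_sq_le (μ := μ) (ρ := fun _ => 1) (ε := B) (fun _ => zero_le_one)
    (fun v => by simpa using hM.integrable v) (fun v => by simpa using hB v) v w
  simp only [mul_one] at h
  refine (Real.sqrt_le_sqrt h).trans_eq ?_
  rw [Real.sqrt_mul hB0, Real.sqrt_sq (by positivity)]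

/-- The first-order argument is repeated for `x ↦ T x v`. The mixed fourth-moment estimate keeps the
remainder proportional to `‖v‖`, so differentiability holds in operator norm. -/
theorem exists_fderiv_fderiv_transform [IsFiniteMeasure μ] (hM : HasWeakMoment μ 4)
    (hM2 : HasWeakMoment μ 2) (g : Lp (Complexification V) 2 μ) {T : X → X →L[ℝ] V}
    (hT : ∀ x v, T x v = transform μ (derivSymbol v g) x) :
    ∃ T' : X → X →L[ℝ] X →L[ℝ] V,
      (∀ x v w, T' x w v = transform μ (derivSymbol w (derivSymbol v g)) x) ∧
      ∀ x, HasFDerivAt T (T' x) x := by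
  obtain ⟨B, hB0, hB⟩ := hM.exists_sqrt_bound_mul
  have hI := fun v w => (hM.derivSymbol_derivSymbol_bounds g v w).1
  have hsymm : ∀ v w, derivSymbol w (derivSymbol v g) = derivSymbol v (derivSymbol w g) :=
    fun v w => funext fun s => by simp only [derivSymbol, map_smul, smul_smul, mul_comm]
  have hadd : ∀ x v w w', transform μ (derivSymbol (w + w') (derivSymbol v g)) x =
      transform μ (derivSymbol w (derivSymbol v g)) x +
        transform μ (derivSymbol w' (derivSymbol v g)) x := fun x v w w' => by
    rw [← transform_add (hI v w) (hI v w')]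
    congr 1
    exact funext fun s => derivSymbol_add w w' _ s
  have hsmul : ∀ x v (c : ℝ) w, transform μ (derivSymbol (c • w) (derivSymbol v g)) x =
      c • transform μ (derivSymbol w (derivSymbol v g)) x := fun x v c w => by
    rw [← transform_smul]
    congr 1
    exact funext fun s => derivSymbol_smul c w _ s
  let T' : X → X →L[ℝ] X →L[ℝ] V := fun x => LinearMap.mkContinuous₂
    (LinearMap.mk₂ ℝ (fun w v => transform μ (derivSymbol w (derivSymbol v g)) x)
      (fun w w' v => hadd x v w w') (fun c w v => hsmul x v c w)
      (fun w v v' => by rw [hsymm, hadd, hsymm w v, hsymm w v'])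
      (fun c w v => by rw [hsymm, hsmul, hsymm w v]))
    (B * ‖g‖) fun w v => by
      refine ((hM.derivSymbol_derivSymbol_bounds g v w).2.1 x).trans ?_
      calc _ ≤ B * (‖w‖ * ‖v‖) * ‖g‖ := by gcongr; exact hB v w
        _ = _ := by ring
  refine ⟨T', fun _ _ _ => rfl, fun x => ?_⟩
  rw [hasFDerivAt_iff_isLittleO_nhds_zero, Asymptotics.isLittleO_iff]
  intro c hc
  obtain ⟨δ, hδ, h⟩ := Metric.eventually_nhds_iff.1
    (hM.small ((c / (‖g‖ + 1)) ^ 2 / 2) (by positivity))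
  filter_upwards [Metric.ball_mem_nhds (0 : X) hδ] with w hw
  refine ContinuousLinearMap.opNorm_le_bound _ (by positivity) fun v => ?_
  change ‖T (x + w) v - T x v - transform μ (derivSymbol w (derivSymbol v g)) x‖ ≤ _
  rw [hT, hT]
  refine norm_sub_sub_le_of_hasDerivAt_line (f := transform μ (derivSymbol v g))
    (φ := fun x => transform μ (derivSymbol w (derivSymbol v g)) x)
    (fun τ => hasDerivAt_transform (hM2.derivSymbol_bounds g v).1 w (hI v w) x τ) fun τ hτ => ?_
  refine ((hM.derivSymbol_derivSymbol_bounds g v w).2.2 x (τ • w)).trans ?_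
  have hτw : dist (τ • w) 0 < δ := by
    rw [dist_zero_right, norm_smul, Real.norm_of_nonneg hτ.1]
    exact (mul_le_of_le_one_left (norm_nonneg _) hτ.2).trans_lt (by simpa using hw)
  have hcos : ∀ v : X, Integrable
      (fun s => (inner ℝ s v : ℝ) ^ 4 * (1 - Real.cos (inner ℝ s (τ • w)))) μ := fun v =>
    (integrable_sq_mul_one_sub_cos (hM.memLp_inner_mul_inner v v) (τ • w)).congr
      (ae_of_all _ fun s => by ring)
  have hs := integral_mul_sq_le (μ := μ) (fun s => by
    linarith [Real.cos_le_one (inner ℝ s (τ • w))]) hcos (h hτw) v w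
  calc _ ≤ √((c / (‖g‖ + 1) * (‖w‖ * ‖v‖)) ^ 2) * ‖g‖ := by
        gcongr
        linarith
    _ = c * ‖w‖ * ‖v‖ * (‖g‖ / (‖g‖ + 1)) := by
        rw [Real.sqrt_sq (by positivity)]
        ring
    _ ≤ c * ‖w‖ * ‖v‖ := mul_le_of_le_one_right (by positivity)
        (div_le_one_of_le₀ (by linarith) (by positivity))

end HasWeakMoment

end Regularity

/-! ### Covariance of the Gaussian measure and traces as expectations. -/

theorem countable_of_orthonormal {ι X : Type*} [NormedAddCommGroup X] [InnerProductSpace ℝ X]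
    [TopologicalSpace.SeparableSpace X] {v : ι → X} (hv : Orthonormal ℝ v) : Countable ι := by
  refine Pairwise.countable_of_isOpen_disjoint (s := fun i => Metric.ball (v i) (1 / 2))
    (fun i j hij => Metric.ball_disjoint_ball ?_) (fun _ => Metric.isOpen_ball)
    fun i => ⟨v i, Metric.mem_ball_self (by norm_num)⟩
  have h : ‖v i - v j‖ ^ 2 = 2 := by
    rw [norm_sub_sq_real, hv.1, hv.1, hv.2 hij]
    norm_num
  rw [dist_eq_norm]
  nlinarith [norm_nonneg (v i - v j)]

section Gaussian

variable {X : Type u} [NormedAddCommGroup X] [InnerProductSpace ℝ X] [CompleteSpace X]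
  [MeasurableSpace X] [BorelSpace X] {C : X →L[ℝ] X} {N : Measure X}

/-- `N` has covariance operator `C` and a finite second moment. -/
structure HasCovariance (C : X →L[ℝ] X) (N : Measure X) : Prop where
  integrable_norm_sq : Integrable (fun z => ‖z‖ ^ 2) N
  integral_inner_mul_inner : ∀ u w : X, ∫ z, (inner ℝ u z : ℝ) * inner ℝ w z ∂N = inner ℝ (C u) w

theorem aemeasurable_inner_right (y : X) : AEMeasurable (fun z : X => (inner ℝ y z : ℝ)) N :=
  (by fun_prop : Continuous fun z : X => (inner ℝ y z : ℝ)).aemeasurable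

theorem IsCentredGaussian.isProbabilityMeasure (hN : IsCentredGaussian C N) :
    IsProbabilityMeasure N := by
  have h := hN 0
  have : IsProbabilityMeasure (N.map fun x : X => (inner ℝ (0 : X) x : ℝ)) := by
    rw [h]; infer_instance
  exact Measure.isProbabilityMeasure_of_map (μ := N) (fun x : X => (inner ℝ (0 : X) x : ℝ))

theorem IsCentredGaussian.integrable_inner_sq (hN : IsCentredGaussian C N) (y : X) :
    Integrable (fun z => (inner ℝ y z : ℝ) ^ 2) N := by
  have h : Integrable (fun x : ℝ => x ^ 2) (N.map fun x => (inner ℝ y x : ℝ)) := by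
    rw [hN y]
    exact (memLp_id_gaussianReal 2).integrable_sq
  exact h.comp_aemeasurable (aemeasurable_inner_right y)

theorem IsCentredGaussian.integral_inner_sq (hN : IsCentredGaussian C N) (hC : C.IsPositive)
    (y : X) : ∫ z, (inner ℝ y z : ℝ) ^ 2 ∂N = inner ℝ (C y) y := by
  have h : ∫ z, (inner ℝ y z : ℝ) ^ 2 ∂N =
      ∫ x, x ^ 2 ∂(N.map fun x => (inner ℝ y x : ℝ)) :=
    (integral_map (f := fun x : ℝ => x ^ 2) (aemeasurable_inner_right y)
      (continuous_pow 2).aestronglyMeasurable).symm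
  rw [h, hN y]
  have hv := variance_id_gaussianReal (μ := 0) (v := (inner ℝ (C y) y : ℝ).toNNReal)
  rw [variance_eq_integral (by fun_prop)] at hv
  simpa [Real.coe_toNNReal _ (hC.inner_nonneg_left y)] using hv

theorem IsCentredGaussian.hasCovariance [TopologicalSpace.SeparableSpace X]
    (hN : IsCentredGaussian C N) (hC : C.IsPositive) (hT : IsTraceClass C) :
    HasCovariance C N where
  integrable_norm_sq := by
    have := countable_of_orthonormal (basis X).orthonormal
    have hs : ∀ z : X, HasSum (fun i => (inner ℝ (basis X i) z : ℝ) ^ 2) (‖z‖ ^ 2) := fun z => by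
      have := (basis X).hasSum_inner_mul_inner z z
      rw [real_inner_self_eq_norm_sq] at this
      simpa only [real_inner_comm z, ← sq] using this
    refine ⟨(continuous_norm.pow 2).aestronglyMeasurable, ?_⟩
    rw [hasFiniteIntegral_iff_ofReal (ae_of_all _ fun z => sq_nonneg _)]
    have e : ∀ z : X, ENNReal.ofReal (‖z‖ ^ 2) =
        ∑' i, ENNReal.ofReal ((inner ℝ (basis X i) z : ℝ) ^ 2) := fun z => by
      rw [← (hs z).tsum_eq, ENNReal.ofReal_tsum_of_nonneg (fun i => sq_nonneg _) (hs z).summable]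
    simp only [e]
    rw [lintegral_tsum fun i => ((aemeasurable_inner_right _).pow_const 2).ennreal_ofReal]
    have e2 : ∀ i, ∫⁻ z, ENNReal.ofReal ((inner ℝ (basis X i) z : ℝ) ^ 2) ∂N =
        ENNReal.ofReal (inner ℝ (C (basis X i)) (basis X i)) := fun i => by
      rw [← hN.integral_inner_sq hC, ofReal_integral_eq_lintegral_ofReal
        (hN.integrable_inner_sq _) (ae_of_all _ fun z => sq_nonneg _)]
    simp only [e2]
    rw [← ENNReal.ofReal_tsum_of_nonneg (fun i => hC.inner_nonneg_left _)
      (hT _ (basis X) (basis X))]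
    exact ENNReal.ofReal_lt_top
  integral_inner_mul_inner u w := by
    -- Polarisation: the Gaussian hypothesis only describes one-dimensional marginals, hence
    -- variances.
    have e : ∀ z : X, (inner ℝ u z : ℝ) * inner ℝ w z =
        ((inner ℝ (u + w) z : ℝ) ^ 2 - (inner ℝ (u - w) z : ℝ) ^ 2) / 4 := fun z => by
      rw [inner_add_left, inner_sub_left]
      ring
    simp only [e]
    rw [integral_div, integral_sub (hN.integrable_inner_sq _) (hN.integrable_inner_sq _),
      hN.integral_inner_sq hC, hN.integral_inner_sq hC]
    simp only [map_add, map_sub, inner_add_left, inner_add_right, inner_sub_left, inner_sub_right]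
    have : (inner ℝ (C w) u : ℝ) = inner ℝ (C u) w := by
      rw [hC.isSymmetric.apply_clm, real_inner_comm]
    linarith

namespace HasCovariance

variable (hN : HasCovariance C N)
include hN

theorem integrable_of_norm_le {f : X → ℝ} (hf : Continuous f) {c : ℝ}
    (h : ∀ z, |f z| ≤ c * ‖z‖ ^ 2) : Integrable f N :=
  (hN.integrable_norm_sq.const_mul c).mono' hf.aestronglyMeasurable (ae_of_all _ h)

theorem integrable_inner_mul_inner (u w : X) :
    Integrable (fun z => (inner ℝ u z : ℝ) * inner ℝ w z) N :=
  hN.integrable_of_norm_le (by fun_prop) (c := ‖u‖ * ‖w‖) fun z => by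
    rw [abs_mul]
    calc _ ≤ (‖u‖ * ‖z‖) * (‖w‖ * ‖z‖) := by
          gcongr <;> exact abs_real_inner_le_norm _ _
      _ = _ := by ring

/-- By Bessel's inequality the partial sums are dominated pointwise by `‖T* z‖²`, which is
integrable for `N`. -/
theorem summable_integral_inner_sq (T : X →L[ℝ] X) {ι : Type*} (v : HilbertBasis ι ℝ X) :
    Summable fun i => ∫ z, (inner ℝ (T (v i)) z : ℝ) ^ 2 ∂N := by
  have hi : ∀ y, Integrable (fun z => (inner ℝ y z : ℝ) ^ 2) N := fun y => by
    simpa only [sq] using hN.integrable_inner_mul_inner y y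
  refine summable_of_sum_le (c := ∫ z, ‖T.adjoint z‖ ^ 2 ∂N)
    (fun i => integral_nonneg fun z => sq_nonneg _) fun F => ?_
  rw [← integral_finsetSum _ fun i _ => hi _]
  refine integral_mono (integrable_finsetSum _ fun i _ => hi _)
    (hN.integrable_of_norm_le (by fun_prop) (c := ‖T.adjoint‖ ^ 2) fun z => ?_) fun z => ?_
  · rw [abs_of_nonneg (by positivity), ← mul_pow]
    gcongr
    exact T.adjoint.le_opNorm z
  · have h := v.orthonormal.sum_inner_products_le (T.adjoint z) (s := F)
    refine le_trans (le_of_eq (Finset.sum_congr rfl fun i _ => ?_)) h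
    rw [ContinuousLinearMap.adjoint_inner_right, Real.norm_eq_abs, sq_abs]

theorem summable_integral_norm (T : X →L[ℝ] X) {ι : Type*} (v w : HilbertBasis ι ℝ X) :
    Summable fun i => ∫ z, ‖(inner ℝ (T (v i)) z : ℝ) * inner ℝ (w i) z‖ ∂N := by
  have hi : ∀ y, Integrable (fun z => (inner ℝ y z : ℝ) ^ 2) N := fun y => by
    simpa only [sq] using hN.integrable_inner_mul_inner y y
  have h2 := hN.summable_integral_inner_sq (ContinuousLinearMap.id ℝ X) w
  refine ((hN.summable_integral_inner_sq T v).add h2).of_nonneg_of_le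
    (fun i => integral_nonneg fun z => norm_nonneg _) fun i => ?_
  rw [← integral_add (hi _) (hi _)]
  refine integral_mono (hN.integrable_inner_mul_inner _ _).norm ((hi _).add (hi _)) fun z => ?_
  simp only [ContinuousLinearMap.coe_id', id_eq, norm_mul, Real.norm_eq_abs]
  rw [← sq_abs (inner ℝ (T (v i)) z), ← sq_abs (inner ℝ (w i) z)]
  nlinarith [sq_nonneg (|(inner ℝ (T (v i)) z : ℝ)| - |(inner ℝ (w i) z : ℝ)|),
    sq_nonneg |(inner ℝ (T (v i)) z : ℝ)|, sq_nonneg |(inner ℝ (w i) z : ℝ)|]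

/-- The covariance operator composed with a bounded operator is of trace class. -/
theorem isTraceClass_comp (T : X →L[ℝ] X) : IsTraceClass (C ∘L T) := fun ι v w => by
  refine Summable.of_norm_bounded (hN.summable_integral_norm T v w) fun i => ?_
  rw [ContinuousLinearMap.comp_apply, ← hN.integral_inner_mul_inner]
  exact norm_integral_le_integral_norm _

/-- The trace of `C T` is the expectation of the quadratic form of `T`. -/
theorem opTrace_comp [TopologicalSpace.SeparableSpace X] (T : X →L[ℝ] X) :
    opTrace (C ∘L T) = ∫ z, (inner ℝ (T z) z : ℝ) ∂N := by
  have := countable_of_orthonormal (basis X).orthonormal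
  have h := hasSum_integral_of_summable_integral_norm
    (F := fun i z => (inner ℝ (T (basis X i)) z : ℝ) * inner ℝ (basis X i) z)
    (fun i => hN.integrable_inner_mul_inner _ _) (hN.summable_integral_norm T (basis X) (basis X))
  simp only [hN.integral_inner_mul_inner] at h
  rw [opTrace]
  refine h.tsum_eq.trans (integral_congr_ae (ae_of_all _ fun z => ?_))
  have hz := (basis X).hasSum_inner_mul_inner (T.adjoint z) z
  rw [ContinuousLinearMap.adjoint_inner_left, real_inner_comm] at hz
  refine Eq.trans (tsum_congr fun i => ?_) hz.tsum_eq
  rw [ContinuousLinearMap.adjoint_inner_left, real_inner_comm]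

end HasCovariance

end Gaussian

/-! ### Measurability and integrability of the drift. -/

section Drift

variable {X : Type u} [NormedAddCommGroup X] [InnerProductSpace ℝ X] [CompleteSpace X]
  [TopologicalSpace.SeparableSpace X] [MeasurableSpace X] [BorelSpace X]
  {U : X → ℝ} {Q : Measure X}

/-- Where `U` is differentiable, the directional derivative is a limit of measurable difference
quotients along one fixed null sequence. -/
theorem aemeasurable_inner_gradient (hU : Measurable U) (hd : ∀ᵐ x ∂Q, DifferentiableAt ℝ U x)
    (v : X) : AEMeasurable (fun x => (inner ℝ v (gradient U x) : ℝ)) Q := by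
  let r : ℕ → ℝ := fun n => 1 / ((n : ℝ) + 1)
  have hr : Tendsto r atTop (𝓝[≠] 0) :=
    tendsto_nhdsWithin_iff.2 ⟨tendsto_one_div_add_atTop_nhds_zero_nat, Eventually.of_forall
      fun n => (show (0 : ℝ) < 1 / ((n : ℝ) + 1) by positivity).ne'⟩
  refine aemeasurable_of_tendsto_metrizable_ae atTop
    (f := fun n x => (r n)⁻¹ • (U (x + r n • v) - U x)) (fun n => ?_) ?_
  · have h := hU.comp
      (continuous_id.add continuous_const : Continuous fun x => x + r n • v).measurable
    exact ((h.sub hU).const_smul ((r n)⁻¹)).aemeasurable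
  · filter_upwards [hd] with x hx
    have h := (hx.hasFDerivAt.hasLineDerivAt v).tendsto_slope_zero.comp hr
    have e : (fderiv ℝ U x) v = inner ℝ v (gradient U x) := by
      rw [real_inner_comm, gradient, InnerProductSpace.toDual_symm_apply]
    rw [e] at h
    exact h

theorem aestronglyMeasurable_gradient (hU : Measurable U)
    (hd : ∀ᵐ x ∂Q, DifferentiableAt ℝ U x) : AEStronglyMeasurable (gradient U) Q := by
  have := countable_of_orthonormal (basis X).orthonormal
  refine aestronglyMeasurable_of_tendsto_ae (atTop : Filter (Finset (basisIndex X)))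
    (f := fun F x => ∑ i ∈ F, (inner ℝ (basis X i) (gradient U x) : ℝ) • basis X i)
    (fun F => ?_) (ae_of_all _ fun x => ?_)
  · exact Finset.aestronglyMeasurable_fun_sum _ fun i _ =>
      (aemeasurable_inner_gradient hU hd _).aestronglyMeasurable.smul_const _
  · have h := (basis X).hasSum_repr (gradient U x)
    simp only [HilbertBasis.repr_apply_apply] at h
    exact h

theorem integrable_drift [IsProbabilityMeasure Q] {C : X →L[ℝ] X} (hU : Measurable U)
    (hd : ∀ᵐ x ∂Q, DifferentiableAt ℝ U x) (h2 : Integrable (fun x => ‖x‖ ^ 2) Q)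
    (hp : Integrable (fun x => ‖C (gradient U x)‖) Q) : Integrable (drift C U) Q := by
  have : SecondCountableTopology X := UniformSpace.secondCountable_of_separable X
  refine Integrable.add ?_ ?_
  · refine ((integrable_const (1 : ℝ)).add h2).mono' aestronglyMeasurable_id
      (ae_of_all _ fun x => ?_)
    simp only [Pi.add_apply]
    nlinarith [sq_nonneg (‖x‖ - 1), norm_nonneg x]
  · exact (integrable_norm_iff
      (C.continuous.comp_aestronglyMeasurable (aestronglyMeasurable_gradient hU hd))).1 hp

end Drift

/-! ### Averaging functionals on `L²(μ)` over `Q`. -/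

section Duality

variable {Ω S E : Type*} [MeasurableSpace Ω] [MeasurableSpace S] {Q : Measure Ω} {μ : Measure S}
  [NormedAddCommGroup E] [InnerProductSpace ℝ E]

theorem integrable_mul_norm_and_le {p : S → ℝ} {m : ℝ}
    (h : ∀ q : Lp ℝ 2 μ, Integrable (fun s => p s * ‖q s‖) μ ∧
      ∫ s, p s * ‖q s‖ ∂μ ≤ m * ‖q‖) (g : Lp E 2 μ) :
    Integrable (fun s => p s * ‖g s‖) μ ∧ ∫ s, p s * ‖g s‖ ∂μ ≤ m * ‖g‖ := by
  have hg : MemLp (fun s => ‖g s‖) 2 μ := (Lp.memLp g).norm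
  have e : ‖hg.toLp _‖ = ‖g‖ := by
    rw [← sq_eq_sq₀ (norm_nonneg _) (norm_nonneg _), norm_Lp_two_sq, norm_Lp_two_sq]
    refine integral_congr_ae ?_
    filter_upwards [hg.coeFn_toLp] with s h1
    simp [h1]
  have e2 : (fun s => p s * ‖hg.toLp _ s‖) =ᵐ[μ] fun s => p s * ‖g s‖ := by
    filter_upwards [hg.coeFn_toLp] with s h1
    simp [h1]
  obtain ⟨h1, h2⟩ := h (hg.toLp _)
  exact ⟨h1.congr e2, by rwa [integral_congr_ae e2, e] at h2⟩

variable [IsProbabilityMeasure Q] [IsFiniteMeasure μ] [CompleteSpace E]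

/-- If `Ψ x` defines bounded functionals on `L²(μ)` with `Q`-integrable bounds, then the mean
`s ↦ ∫ Ψ x s dQ(x)` belongs to `L²(μ)` and represents the mean of these functionals. -/
theorem exists_Lp_mean {Ψ : Ω → S → E}
    (hΨ : AEStronglyMeasurable (Function.uncurry Ψ) (Q.prod μ)) {M : Ω → ℝ} (hM : Integrable M Q)
    (hb : ∀ x, ∀ q : Lp ℝ 2 μ, Integrable (fun s => ‖Ψ x s‖ * ‖q s‖) μ ∧
      ∫ s, ‖Ψ x s‖ * ‖q s‖ ∂μ ≤ M x * ‖q‖) :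
    ∃ h : Lp E 2 μ, h =ᵐ[μ] (fun s => ∫ x, Ψ x s ∂Q) ∧ ∀ g : Lp E 2 μ,
      Integrable (fun x => ∫ s, inner ℝ (g s) (Ψ x s) ∂μ) Q ∧
      ∫ x, ∫ s, inner ℝ (g s) (Ψ x s) ∂μ ∂Q = inner ℝ g h := by
  have hbE : ∀ x, ∀ g : Lp E 2 μ, Integrable (fun s => ‖Ψ x s‖ * ‖g s‖) μ ∧
      ∫ s, ‖Ψ x s‖ * ‖g s‖ ∂μ ≤ M x * ‖g‖ := fun x => integrable_mul_norm_and_le (hb x)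
  have hsec : ∀ᵐ x ∂Q, AEStronglyMeasurable (Ψ x) μ := hΨ.prodMk_left
  have hprod : ∀ g : Lp E 2 μ,
      Integrable (fun p : Ω × S => (inner ℝ (g p.2) (Ψ p.1 p.2) : ℝ)) (Q.prod μ) := fun g => by
    have hm : AEStronglyMeasurable (fun p : Ω × S => (inner ℝ (g p.2) (Ψ p.1 p.2) : ℝ))
        (Q.prod μ) := (Lp.aestronglyMeasurable g).comp_snd.inner hΨ
    refine (integrable_prod_iff hm).2 ⟨?_, ?_⟩
    · filter_upwards [hsec] with x hx
      refine (hbE x g).1.mono' ((Lp.aestronglyMeasurable g).inner hx) (ae_of_all _ fun s => ?_)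
      exact (norm_inner_le_norm _ _).trans_eq (mul_comm _ _)
    · refine (hM.mul_const ‖g‖).mono' hm.norm.integral_prod_right' (ae_of_all _ fun x => ?_)
      rw [Real.norm_of_nonneg (integral_nonneg fun s => norm_nonneg _)]
      refine le_trans (integral_mono_of_nonneg (ae_of_all _ fun s => norm_nonneg _) (hbE x g).1
        (ae_of_all _ fun s => ?_)) (hbE x g).2
      exact (norm_inner_le_norm _ _).trans_eq (mul_comm _ _)
  -- Testing the bound with the constant `1`, which is in `L²(μ)` because `μ` is finite, gives joint
  -- integrability of `Ψ`.
  have hΨi : Integrable (Function.uncurry Ψ) (Q.prod μ) := by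
    have h1 : MemLp (fun _ : S => (1 : ℝ)) 2 μ := memLp_const 1
    have e : ∀ x, (fun s => ‖Ψ x s‖ * ‖h1.toLp _ s‖) =ᵐ[μ] fun s => ‖Ψ x s‖ := fun x => by
      filter_upwards [h1.coeFn_toLp] with s hs
      rw [hs, norm_one, mul_one]
    refine (integrable_prod_iff hΨ).2 ⟨?_, ?_⟩
    · filter_upwards [hsec] with x hx
      exact (integrable_norm_iff hx).1 ((hb x (h1.toLp _)).1.congr (e x))
    · refine (hM.mul_const ‖h1.toLp _‖).mono' hΨ.norm.integral_prod_right'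
        (ae_of_all _ fun x => ?_)
      rw [Real.norm_of_nonneg (integral_nonneg fun s => norm_nonneg _)]
      have h2 := (hb x (h1.toLp _)).2
      rwa [integral_congr_ae (e x)] at h2
  set H : S → E := fun s => ∫ x, Ψ x s ∂Q with hH
  have hHi : Integrable H μ := hΨi.integral_prod_right
  have hswap : ∀ g : Lp E 2 μ, ∫ x, ∫ s, (inner ℝ (g s) (Ψ x s) : ℝ) ∂μ ∂Q =
      ∫ s, inner ℝ (g s) (H s) ∂μ := fun g => by
    rw [integral_integral_swap (hprod g)]
    refine integral_congr_ae ?_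
    filter_upwards [hΨi.prod_left_ae] with s hs
    exact integral_inner hs (g s)
  have hsnd : ∀ {p : S → Prop}, (∀ᵐ s ∂μ, p s) → ∀ᵐ z ∂(Q.prod μ), p z.2 :=
    fun hp => Measure.quasiMeasurePreserving_snd.ae hp
  let L : Lp E 2 μ →L[ℝ] ℝ := LinearMap.mkContinuous
    { toFun := fun g => ∫ p : Ω × S, (inner ℝ (g p.2) (Ψ p.1 p.2) : ℝ) ∂(Q.prod μ)
      map_add' := fun g g' => by
        rw [← integral_add (hprod g) (hprod g')]
        refine integral_congr_ae ?_
        filter_upwards [hsnd (Lp.coeFn_add g g')] with p hp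
        rw [hp, Pi.add_apply, inner_add_left]
      map_smul' := fun c g => by
        rw [RingHom.id_apply, smul_eq_mul, ← integral_const_mul]
        refine integral_congr_ae ?_
        filter_upwards [hsnd (Lp.coeFn_smul c g)] with p hp
        rw [hp, Pi.smul_apply, real_inner_smul_left] }
    (∫ x, M x ∂Q) fun g => by
      change ‖∫ p : Ω × S, (inner ℝ (g p.2) (Ψ p.1 p.2) : ℝ) ∂(Q.prod μ)‖ ≤ _
      rw [integral_prod _ (hprod g), ← integral_mul_const]
      refine norm_integral_le_of_norm_le (hM.mul_const _) (ae_of_all _ fun x => ?_)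
      refine (norm_integral_le_of_norm_le (hbE x g).1 (ae_of_all _ fun s => ?_)).trans (hbE x g).2
      exact (norm_inner_le_norm _ _).trans_eq (mul_comm _ _)
  have hL : ∀ g, L g = ∫ x, ∫ s, (inner ℝ (g s) (Ψ x s) : ℝ) ∂μ ∂Q := fun g =>
    integral_prod _ (hprod g)
  obtain ⟨h, hh⟩ : ∃ h : Lp E 2 μ, ∀ g, L g = inner ℝ g h :=
    ⟨(InnerProductSpace.toDual ℝ _).symm L, fun g => by
      rw [real_inner_comm, InnerProductSpace.toDual_symm_apply]⟩
  refine ⟨h, ?_, fun g => ⟨(hprod g).integral_prod_left, by rw [← hL, hh]⟩⟩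
  -- The mean `H` is only known to be integrable, while `h` comes from the Riesz theorem. Pairing
  -- with indicators times constant vectors shows that both have the same integral over every
  -- measurable set.
  refine ((Lp.memLp h).integrable (by norm_num)).ae_eq_of_forall_setIntegral_eq _ _ hHi
    fun A hA _ => ext_inner_left ℝ fun c => ?_
  have h1 := hh (indicatorConstLp 2 hA (measure_ne_top μ A) c)
  rw [L2.inner_indicatorConstLp_eq_inner_setIntegral, hL, hswap] at h1
  rw [← h1, ← integral_inner hHi.integrableOn, ← integral_indicator hA]
  refine integral_congr_ae ?_
  filter_upwards [indicatorConstLp_coeFn (p := 2) (hs := hA) (hμs := measure_ne_top μ A) (c := c)]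
    with s hs
  rw [hs]
  by_cases hsA : s ∈ A <;> simp [hsA]

end Duality

/-! ### Fubini under weak moment bounds. -/

section TraceFubini

variable {X : Type*} [NormedAddCommGroup X] [InnerProductSpace ℝ X]
  [TopologicalSpace.SeparableSpace X] [MeasurableSpace X] [BorelSpace X]
  {N μ : Measure X} [SFinite N] [SFinite μ] {E : Type*} [NormedAddCommGroup E]
  [InnerProductSpace ℝ E]

/-- Cauchy–Schwarz in `s` at fixed `z` leaves `c ‖z‖² ‖g‖`, integrable for `N`. Averaging over `z`
first makes `s ↦ E_N|κ(s, z)|` pair boundedly with `L²(μ)`, although its pointwise bound by a power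
of `‖s‖` need not. -/
theorem integrable_prod_of_sqrt_bound (hN : Integrable (fun z => ‖z‖ ^ 2) N) {κ : X → X → ℝ}
    (hκ : Continuous (Function.uncurry κ)) (hq : ∀ z, MemLp (fun s => κ s z) 2 μ) {c : ℝ}
    (hc : ∀ z, √(∫ s, κ s z ^ 2 ∂μ) ≤ c * ‖z‖ ^ 2) (g : Lp E 2 μ) :
    Integrable (fun p : X × X => |κ p.2 p.1| * ‖g p.2‖) (N.prod μ) ∧
      Integrable (fun s => (∫ z, |κ s z| ∂N) * ‖g s‖) μ ∧
      ∫ s, (∫ z, |κ s z| ∂N) * ‖g s‖ ∂μ ≤ (c * ∫ z, ‖z‖ ^ 2 ∂N) * ‖g‖ := by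
  have : SecondCountableTopology X := UniformSpace.secondCountable_of_separable X
  have hm : AEStronglyMeasurable (fun p : X × X => |κ p.2 p.1| * ‖g p.2‖) (N.prod μ) :=
    ((hκ.comp continuous_swap).abs.aestronglyMeasurable).mul
      (Lp.aestronglyMeasurable g).comp_snd.norm
  have hbd : ∀ z, ∫ s, |κ s z| * ‖g s‖ ∂μ ≤ c * ‖z‖ ^ 2 * ‖g‖ := fun z =>
    (integral_abs_mul_norm_le (hq z) g).2.trans (by gcongr; exact hc z)
  have hi : Integrable (fun p : X × X => |κ p.2 p.1| * ‖g p.2‖) (N.prod μ) := by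
    refine (integrable_prod_iff hm).2 ⟨ae_of_all _ fun z =>
      (integral_abs_mul_norm_le (hq z) g).1, ?_⟩
    refine ((hN.const_mul c).mul_const ‖g‖).mono' hm.norm.integral_prod_right'
      (ae_of_all _ fun z => ?_)
    rw [Real.norm_of_nonneg (integral_nonneg fun s => norm_nonneg _)]
    refine le_trans (le_of_eq (integral_congr_ae (ae_of_all _ fun s => ?_))) (hbd z)
    exact Real.norm_of_nonneg (by positivity)
  have hi2 := hi.integral_prod_right
  simp only [integral_mul_const] at hi2
  refine ⟨hi, hi2, ?_⟩
  have hs := integral_integral_swap (f := fun z s => |κ s z| * ‖g s‖) hi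
  simp only [integral_mul_const] at hs
  rw [← hs, ← integral_const_mul, ← integral_mul_const]
  exact integral_mono hi.integral_prod_left ((hN.const_mul c).mul_const ‖g‖) hbd

end TraceFubini

theorem inner_quarterTurn {V : Type*} [NormedAddCommGroup V] [InnerProductSpace ℝ V]
    (w w' : Complexification V) :
    (inner ℝ w (quarterTurn w') : ℝ) = -inner ℝ (quarterTurn w) w' := by
  simp only [WithLp.prod_inner_apply, quarterTurn, ContinuousLinearMap.comp_apply]
  simp [add_comm]

/-! ### The spectral formula for a general symbol. -/

section Abstract

variable {X : Type*} [NormedAddCommGroup X] [InnerProductSpace ℝ X] [MeasurableSpace X]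
  [BorelSpace X] {V : Type*} [NormedAddCommGroup V] [InnerProductSpace ℝ V] [CompleteSpace V]

/-- The spectral representation of a kernel Stein discrepancy. -/
theorem ksd_sq_eq_lintegral {k : PDKernel X} {Q μ : Measure X} [IsProbabilityMeasure Q]
    [IsFiniteMeasure μ] (hk : ∀ x y : X, (k x y : ℂ) = charFun μ (x - y))
    {A : (X → V) → X → ℝ} {Ψ : X → X → Complexification V}
    (hΨ : AEStronglyMeasurable (Function.uncurry Ψ) (Q.prod μ)) {M : X → ℝ} (hM : Integrable M Q)
    (hb : ∀ x, ∀ q : Lp ℝ 2 μ, Integrable (fun s => ‖Ψ x s‖ * ‖q s‖) μ ∧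
      ∫ s, ‖Ψ x s‖ * ‖q s‖ ∂μ ≤ M x * ‖q‖)
    (hA : ∀ (g : Lp (Complexification V) 2 μ) x,
      A (transform μ g) x = ∫ s, inner ℝ (g s) (Ψ x s) ∂μ) :
    (∀ g : Lp (Complexification V) 2 μ, Integrable (A (transform μ g)) Q) ∧ ksd k A Q ≠ ⊤ ∧
      ksd k A Q ^ 2 = ∫⁻ s, ENNReal.ofReal (‖∫ x, Ψ x s ∂Q‖ ^ 2) ∂μ := by
  obtain ⟨h, hae, hh⟩ := exists_Lp_mean hΨ hM hb
  have hksd : ksd k A Q = ENNReal.ofReal ‖h‖ := ksd_eq_norm hk fun g => by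
    simp only [hA]
    exact (hh g).2
  refine ⟨fun g => ?_, hksd ▸ ENNReal.ofReal_ne_top, ?_⟩
  · rw [show A (transform μ g) = _ from funext (hA g)]
    exact (hh g).1
  · rw [hksd, ← ENNReal.ofReal_pow (norm_nonneg _), norm_Lp_two_sq,
      ofReal_integral_eq_lintegral_ofReal (Lp.memLp h).integrable_norm_pow'
        (ae_of_all _ fun s => sq_nonneg _)]
    refine lintegral_congr_ae ?_
    filter_upwards [hae] with s hs
    rw [hs]

theorem integrable_const_mul_norm {μ : Measure X} [IsFiniteMeasure μ] (c : ℝ) (q : Lp ℝ 2 μ) :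
    Integrable (fun s => |c| * ‖q s‖) μ ∧
      ∫ s, |c| * ‖q s‖ ∂μ ≤ √(μ.real Set.univ) * |c| * ‖q‖ := by
  obtain ⟨h1, h2⟩ := integral_abs_mul_norm_le (memLp_const (μ := μ) (p := 2) c) q
  refine ⟨h1, h2.trans_eq ?_⟩
  rw [integral_const, smul_eq_mul, Real.sqrt_mul measureReal_nonneg, Real.sqrt_sq_eq_abs]

theorem integrable_mul_and_le_of_le {μ : Measure X} {p p₁ p₂ : X → ℝ} {q : X → ℝ} {a b : ℝ}
    (hp : AEStronglyMeasurable p μ) (hq : AEStronglyMeasurable q μ) (hp0 : ∀ s, 0 ≤ p s)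
    (h : ∀ s, p s ≤ p₁ s + p₂ s)
    (h₁ : Integrable (fun s => p₁ s * ‖q s‖) μ ∧ ∫ s, p₁ s * ‖q s‖ ∂μ ≤ a)
    (h₂ : Integrable (fun s => p₂ s * ‖q s‖) μ ∧ ∫ s, p₂ s * ‖q s‖ ∂μ ≤ b) :
    Integrable (fun s => p s * ‖q s‖) μ ∧ ∫ s, p s * ‖q s‖ ∂μ ≤ a + b := by
  have hle : ∀ s, p s * ‖q s‖ ≤ p₁ s * ‖q s‖ + p₂ s * ‖q s‖ := fun s => by
    rw [← add_mul]
    exact mul_le_mul_of_nonneg_right (h s) (norm_nonneg _)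
  have h0 : ∀ s, 0 ≤ p s * ‖q s‖ := fun s => mul_nonneg (hp0 s) (norm_nonneg _)
  refine ⟨(h₁.1.add h₂.1).mono' (hp.mul hq.norm) (ae_of_all _ fun s => ?_), ?_⟩
  · rw [Real.norm_of_nonneg (h0 s)]
    exact hle s
  · refine (integral_mono_of_nonneg (ae_of_all _ h0) (h₁.1.add h₂.1) (ae_of_all _ hle)).trans ?_
    rw [integral_add' h₁.1 h₂.1]
    exact add_le_add h₁.2 h₂.2

end Abstract

/-! ### The vectorised Stein operator. -/

section Vector

variable {X : Type u} [NormedAddCommGroup X] [InnerProductSpace ℝ X] [CompleteSpace X]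

/-- The symbol of the vectorised Stein operator: `(Γ cos⟨s, ·⟩ (x), Γ sin⟨s, ·⟩ (x))`. -/
def vecSymbol (C : X →L[ℝ] X) (U : X → ℝ) (x s : X) : Complexification X :=
  -quarterTurn (feature (inner ℝ s x) (C s)) - feature (inner ℝ s x) (drift C U x)

theorem norm_vecSymbol_le (C : X →L[ℝ] X) (U : X → ℝ) (x s : X) :
    ‖vecSymbol C U x s‖ ≤ ‖C s‖ + ‖drift C U x‖ := by
  refine (norm_sub_le _ _).trans_eq ?_
  rw [norm_neg, norm_quarterTurn, norm_feature, norm_feature]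

theorem inner_vecSymbol (C : X →L[ℝ] X) (U : X → ℝ) (x s : X) (w : Complexification X) :
    (inner ℝ w (vecSymbol C U x s) : ℝ) = inner ℝ (C s) (phase (inner ℝ s x) (quarterTurn w)) -
      inner ℝ (phase (inner ℝ s x) w) (drift C U x) := by
  rw [vecSymbol, inner_sub_right, inner_neg_right, inner_quarterTurn, neg_neg, inner_feature,
    inner_feature, real_inner_comm]

theorem hasGradientAt_comp_inner {f : ℝ → ℝ} {f' : ℝ} (s x : X)
    (hf : HasDerivAt f f' (inner ℝ s x)) :
    HasGradientAt (fun z => f (inner ℝ s z)) (f' • s) x := by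
  rw [hasGradientAt_iff_hasFDerivAt]
  have h := hf.comp_hasFDerivAt x (innerSL ℝ s).hasFDerivAt
  convert! h using 1
  ext z
  simp

theorem cexpInner_re (s z : X) : (cexpInner s z).re = Real.cos (inner ℝ s z) := by
  rw [cexpInner, mul_comm, Complex.exp_ofReal_mul_I_re]

theorem cexpInner_im (s z : X) : (cexpInner s z).im = Real.sin (inner ℝ s z) := by
  rw [cexpInner, mul_comm, Complex.exp_ofReal_mul_I_im]

theorem gradient_cos_inner (s : X) :
    gradient (fun z => Real.cos (inner ℝ s z)) = fun x => -Real.sin (inner ℝ s x) • s :=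
  funext fun x => (hasGradientAt_comp_inner s x (Real.hasDerivAt_cos _)).gradient

theorem gradient_sin_inner (s : X) :
    gradient (fun z => Real.sin (inner ℝ s z)) = fun x => Real.cos (inner ℝ s x) • s :=
  funext fun x => (hasGradientAt_comp_inner s x (Real.hasDerivAt_sin _)).gradient

theorem gammaOpC_cexpInner (C : X →L[ℝ] X) (U : X → ℝ) (s : X) :
    gammaOpC C U (cexpInner s) = fun x => vecSymbol C U x s := by
  funext x
  simp only [gammaOpC, cexpInner_re, cexpInner_im, gammaOp, gradient_cos_inner, gradient_sin_inner]
  apply WithLp.ofLp_injective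
  ext1
  · change _ = -(Real.sin (inner ℝ s x) • C s) - Real.cos (inner ℝ s x) • drift C U x
    simp
  · change _ = - -(Real.cos (inner ℝ s x) • C s) - Real.sin (inner ℝ s x) • drift C U x
    simp

variable [TopologicalSpace.SeparableSpace X] [MeasurableSpace X] [BorelSpace X]
  {C : X →L[ℝ] X} {U : X → ℝ} {N Q μ : Measure X}

theorem aestronglyMeasurable_feature_prod [SFinite Q] [SFinite μ] {V : Type*}
    [NormedAddCommGroup V] [InnerProductSpace ℝ V] {f : X × X → V}
    (hf : AEStronglyMeasurable f (Q.prod μ)) :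
    AEStronglyMeasurable (fun p : X × X => feature (inner ℝ p.2 p.1) (f p)) (Q.prod μ) := by
  have : SecondCountableTopology X := UniformSpace.secondCountable_of_separable X
  have h : Continuous fun p : X × X => (inner ℝ p.2 p.1 : ℝ) := by fun_prop
  exact continuous_feature.comp_aestronglyMeasurable
    (f := fun p : X × X => ((inner ℝ p.2 p.1 : ℝ), f p)) (h.aestronglyMeasurable.prodMk hf)

theorem aestronglyMeasurable_vecSymbol [SFinite Q] [SFinite μ] (hd : Integrable (drift C U) Q) :
    AEStronglyMeasurable (Function.uncurry (vecSymbol C U)) (Q.prod μ) := by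
  have : SecondCountableTopology X := UniformSpace.secondCountable_of_separable X
  have h : Continuous fun p : X × X => C p.2 := by fun_prop
  exact (quarterTurn.continuous.comp_aestronglyMeasurable
    (aestronglyMeasurable_feature_prod h.aestronglyMeasurable)).neg.sub
      (aestronglyMeasurable_feature_prod hd.1.comp_fst)

theorem integrable_vecSymbol [IsProbabilityMeasure Q] (hd : Integrable (drift C U) Q) (s : X) :
    Integrable (fun x => vecSymbol C U x s) Q := by
  have : SecondCountableTopology X := UniformSpace.secondCountable_of_separable X
  have hf : ∀ {f : X → X}, AEStronglyMeasurable f Q →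
      AEStronglyMeasurable (fun x => feature (inner ℝ s x) (f x)) Q := fun hf =>
    continuous_feature.comp_aestronglyMeasurable (f := fun x => ((inner ℝ s x : ℝ), _))
      ((by fun_prop : Continuous fun x : X => (inner ℝ s x : ℝ)).aestronglyMeasurable.prodMk hf)
  refine ((integrable_const ‖C s‖).add hd.norm).mono' ?_
    (ae_of_all _ fun x => norm_vecSymbol_le C U x s)
  exact (quarterTurn.continuous.comp_aestronglyMeasurable
    (hf aestronglyMeasurable_const)).neg.sub (hf hd.1)

/-- `‖C s‖² = E_N[⟨s, z⟩ ⟨C s, z⟩]`; bound the second factor by `‖C s‖ ‖z‖` and cancel. This gives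
`‖C s‖` the form of an average over `z` to which the weak second moment applies. -/
theorem HasCovariance.norm_apply_le (hN : HasCovariance C N) (s : X) :
    ‖C s‖ ≤ ∫ z, |(inner ℝ s z : ℝ) * ‖z‖| ∂N := by
  have hi : Integrable (fun z => |(inner ℝ s z : ℝ) * ‖z‖|) N :=
    hN.integrable_of_norm_le (by fun_prop) (c := ‖s‖) fun z => by
      rw [abs_abs, abs_mul, abs_norm, sq, ← mul_assoc]
      gcongr
      exact abs_real_inner_le_norm _ _
  have h : ‖C s‖ * ‖C s‖ ≤ (∫ z, |(inner ℝ s z : ℝ) * ‖z‖| ∂N) * ‖C s‖ := by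
    rw [← real_inner_self_eq_norm_mul_norm, ← hN.integral_inner_mul_inner, ← integral_mul_const]
    refine integral_mono (hN.integrable_inner_mul_inner _ _) (hi.mul_const _) fun z => ?_
    refine (le_abs_self _).trans ?_
    simp only [abs_mul, abs_norm]
    rw [mul_assoc, mul_comm ‖z‖]
    gcongr
    exact abs_real_inner_le_norm _ _
  rcases (norm_nonneg (C s)).eq_or_lt with h0 | h0
  · exact h0 ▸ integral_nonneg fun z => abs_nonneg _
  · exact le_of_mul_le_mul_right h h0

theorem HasWeakMoment.memLp_inner_mul_norm (hM : HasWeakMoment μ 2) (z : X) :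
    MemLp (fun s => (inner ℝ s z : ℝ) * ‖z‖) 2 μ := (hM.memLp_inner z).mul_const _

theorem HasWeakMoment.exists_sqrt_bound_mul_norm (hM : HasWeakMoment μ 2) : ∃ B, 0 ≤ B ∧ ∀ z : X,
    √(∫ s, ((inner ℝ s z : ℝ) * ‖z‖) ^ 2 ∂μ) ≤ B * ‖z‖ ^ 2 := by
  obtain ⟨B, hB0, hB⟩ := hM.exists_sqrt_bound
  refine ⟨B, hB0, fun z => ?_⟩
  simp only [mul_pow, integral_mul_const]
  rw [Real.sqrt_mul (integral_nonneg fun s => sq_nonneg _), Real.sqrt_sq (norm_nonneg _), sq,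
    ← mul_assoc]
  gcongr
  exact hB z

/-- The `C s` part uses the Gaussian average above, the drift part only that `μ` is finite. The
bound is affine in `‖drift‖`, hence integrable for `Q`. -/
theorem vecSymbol_bound [SFinite N] [IsFiniteMeasure μ] (hN : HasCovariance C N)
    (hM : HasWeakMoment μ 2) :
    ∃ c, ∀ x, ∀ q : Lp ℝ 2 μ, Integrable (fun s => ‖vecSymbol C U x s‖ * ‖q s‖) μ ∧
      ∫ s, ‖vecSymbol C U x s‖ * ‖q s‖ ∂μ ≤
        (c + √(μ.real Set.univ) * ‖drift C U x‖) * ‖q‖ := by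
  have : SecondCountableTopology X := UniformSpace.secondCountable_of_separable X
  obtain ⟨B, hB0, hB⟩ := hM.exists_sqrt_bound_mul_norm
  refine ⟨B * ∫ z, ‖z‖ ^ 2 ∂N, fun x q => ?_⟩
  rw [add_mul]
  have h1 := (integrable_prod_of_sqrt_bound hN.integrable_norm_sq
    (κ := fun s z => (inner ℝ s z : ℝ) * ‖z‖) (by unfold Function.uncurry; fun_prop)
    hM.memLp_inner_mul_norm hB q).2
  have h2 := integrable_const_mul_norm (μ := μ) ‖drift C U x‖ q
  simp only [abs_norm] at h2
  refine integrable_mul_and_le_of_le ?_ (Lp.aestronglyMeasurable q) (fun s => norm_nonneg _)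
    (fun s => (norm_vecSymbol_le C U x s).trans ?_) h1 h2
  · refine Continuous.aestronglyMeasurable ?_
    have hf : ∀ {f : X → X}, Continuous f → Continuous fun s => feature (inner ℝ s x) (f s) :=
      fun hf => continuous_feature.comp (f := fun s => ((inner ℝ s x : ℝ), _))
        ((by fun_prop : Continuous fun s : X => (inner ℝ s x : ℝ)).prodMk hf)
    exact ((quarterTurn.continuous.comp (hf C.continuous)).neg.sub (hf continuous_const)).norm
  · gcongr
    exact hN.norm_apply_le s

/-- The action of the vectorised Stein operator on Fourier transforms. -/
theorem vecSteinOp_transform [SFinite N] [IsFiniteMeasure μ] (hN : HasCovariance C N)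
    (hM : HasWeakMoment μ 2) (g : Lp (Complexification X) 2 μ) (x : X) :
    vecSteinOp C U (transform μ g) x = ∫ s, inner ℝ (g s) (vecSymbol C U x s) ∂μ := by
  have : SecondCountableTopology X := UniformSpace.secondCountable_of_separable X
  obtain ⟨T, hT, hT'⟩ := hM.exists_fderiv_transform g
  obtain ⟨B, hB0, hB⟩ := hM.exists_sqrt_bound_mul_norm
  have hg : Integrable g μ := (Lp.memLp g).integrable (by norm_num)
  have hgx := integrable_phase hg x
  have hJ : AEStronglyMeasurable (fun s => phase (inner ℝ s x) (quarterTurn (g s))) μ :=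
    aestronglyMeasurable_phase (quarterTurn.continuous.comp_aestronglyMeasurable hg.1) x
  have hprod : Integrable (fun p : X × X => (inner ℝ p.2 p.1 : ℝ) *
      inner ℝ (phase (inner ℝ p.2 x) (quarterTurn (g p.2))) p.1) (N.prod μ) := by
    refine (integrable_prod_of_sqrt_bound hN.integrable_norm_sq
      (κ := fun s z => (inner ℝ s z : ℝ) * ‖z‖) (by unfold Function.uncurry; fun_prop)
      hM.memLp_inner_mul_norm hB g).1.mono' ?_ (ae_of_all _ fun p => ?_)
    · exact (by fun_prop : Continuous fun p : X × X =>
        (inner ℝ p.2 p.1 : ℝ)).aestronglyMeasurable.mul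
          (hJ.comp_snd.inner continuous_fst.aestronglyMeasurable)
    · rw [norm_mul, Real.norm_eq_abs, abs_mul, abs_norm, mul_assoc, mul_comm ‖p.1‖]
      gcongr
      refine (norm_inner_le_norm _ _).trans ?_
      gcongr
      exact (norm_phase_le _ _).trans_eq (norm_quarterTurn _)
  have htr : opTrace (C ∘L T x) =
      ∫ s, inner ℝ (C s) (phase (inner ℝ s x) (quarterTurn (g s))) ∂μ := by
    rw [hN.opTrace_comp]
    have h1 : ∀ z, (inner ℝ (T x z) z : ℝ) = ∫ s, (inner ℝ s z : ℝ) *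
        inner ℝ (phase (inner ℝ s x) (quarterTurn (g s))) z ∂μ := fun z => by
      rw [hT, transform, real_inner_comm,
        ← integral_inner (integrable_phase (hM.derivSymbol_bounds g z).1 x)]
      refine integral_congr_ae (ae_of_all _ fun s => ?_)
      simp only [derivSymbol, map_smul, inner_smul_right]
      exact congrArg _ (real_inner_comm _ _)
    simp only [h1]
    -- After the exchange, the inner Gaussian integral is a covariance and produces `C s`.
    rw [integral_integral_swap (f := fun z s => (inner ℝ s z : ℝ) *
        inner ℝ (phase (inner ℝ s x) (quarterTurn (g s))) z) hprod]
    exact integral_congr_ae (ae_of_all _ fun s => hN.integral_inner_mul_inner _ _)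
  have hi1 : Integrable (fun s => (inner ℝ (C s)
      (phase (inner ℝ s x) (quarterTurn (g s))) : ℝ)) μ := by
    have := hprod.integral_prod_right
    simpa only [hN.integral_inner_mul_inner] using this
  rw [vecSteinOp, (hT' x).fderiv, htr, transform, real_inner_comm, ← integral_inner hgx,
    ← integral_sub hi1 (hgx.const_inner _)]
  refine integral_congr_ae (ae_of_all _ fun s => ?_)
  simp only [inner_vecSymbol]
  rw [real_inner_comm (drift C U x)]

end Vector

/-! ### The scalar Stein operator. -/

section Scalar

variable {X : Type u} [NormedAddCommGroup X] [InnerProductSpace ℝ X] [CompleteSpace X]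

/-- The symbol of the Stein operator: `(𝒜 cos⟨s, ·⟩ (x), 𝒜 sin⟨s, ·⟩ (x))`. -/
def scalarSymbol (C : X →L[ℝ] X) (U : X → ℝ) (x s : X) : Complexification ℝ :=
  -(inner ℝ (C s) s : ℝ) • feature (inner ℝ s x) 1 +
    (inner ℝ s (drift C U x) : ℝ) • quarterTurn (feature (inner ℝ s x) 1)

theorem norm_scalarSymbol_le (C : X →L[ℝ] X) (U : X → ℝ) (x s : X) :
    ‖scalarSymbol C U x s‖ ≤ |inner ℝ (C s) s| + |inner ℝ s (drift C U x)| := by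
  refine (norm_add_le _ _).trans_eq ?_
  rw [norm_smul, norm_smul, norm_quarterTurn, norm_feature, norm_one, mul_one, mul_one, norm_neg,
    Real.norm_eq_abs, Real.norm_eq_abs]

theorem inner_scalarSymbol (C : X →L[ℝ] X) (U : X → ℝ) (x s : X) (w : Complexification ℝ) :
    (inner ℝ w (scalarSymbol C U x s) : ℝ) = -(inner ℝ (C s) s * phase (inner ℝ s x) w) -
      phase (inner ℝ s x) ((inner ℝ s (drift C U x) : ℝ) • quarterTurn w) := by
  rw [scalarSymbol, inner_add_right, inner_smul_right, inner_smul_right, inner_quarterTurn,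
    inner_feature, inner_feature, map_smul]
  simp only [RCLike.inner_apply, conj_trivial, one_mul, smul_eq_mul]
  ring

/-- The Riesz isomorphism as a linear map. -/
def rieszCLM (X : Type*) [NormedAddCommGroup X] [InnerProductSpace ℝ X] [CompleteSpace X] :
    (X →L[ℝ] ℝ) →L[ℝ] X where
  toFun := (InnerProductSpace.toDual ℝ X).symm
  map_add' := map_add _
  map_smul' c φ := by simp
  cont := (InnerProductSpace.toDual ℝ X).symm.continuous

theorem inner_rieszCLM (φ : X →L[ℝ] ℝ) (v : X) : (inner ℝ (rieszCLM X φ) v : ℝ) = φ v :=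
  InnerProductSpace.toDual_symm_apply

theorem gradient_eq_rieszCLM {f : X → ℝ} {T : X → X →L[ℝ] ℝ}
    (h : ∀ x, HasFDerivAt f (T x) x) : gradient f = fun x => rieszCLM X (T x) :=
  funext fun x => congrArg (InnerProductSpace.toDual ℝ X).symm (h x).fderiv

/-- The isometry of `ℝ × ℝ` with `ℂ`. -/
def toComplex : Complexification ℝ →L[ℝ] ℂ :=
  (WithLp.fstL 2 ℝ ℝ ℝ).smulRight 1 + (WithLp.sndL 2 ℝ ℝ ℝ).smulRight Complex.I

theorem toComplex_apply (w : Complexification ℝ) : toComplex w = ⟨w.fst, w.snd⟩ := by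
  apply Complex.ext <;> simp [toComplex]

theorem norm_toComplex (w : Complexification ℝ) : ‖toComplex w‖ = ‖w‖ := by
  rw [← sq_eq_sq₀ (norm_nonneg _) (norm_nonneg _), WithLp.prod_norm_sq_eq_of_L2, toComplex_apply,
    Complex.sq_norm, Complex.normSq_mk]
  simp [sq]

theorem hasFDerivAt_comp_inner_smul {f : ℝ → ℝ} {f' : ℝ} (s x : X)
    (hf : HasDerivAt f f' (inner ℝ s x)) :
    HasFDerivAt (fun z => f (inner ℝ s z) • s) ((f' • innerSL ℝ s).smulRight s) x :=
  (hf.comp_hasFDerivAt x (innerSL ℝ s).hasFDerivAt).smul_const s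

variable [TopologicalSpace.SeparableSpace X] [MeasurableSpace X] [BorelSpace X]
  {C : X →L[ℝ] X} {U : X → ℝ} {N Q μ : Measure X}

theorem HasCovariance.opTrace_comp_smulRight (hN : HasCovariance C N) (c : ℝ) (s : X) :
    opTrace (C ∘L (c • innerSL ℝ s).smulRight s) = c * inner ℝ (C s) s := by
  rw [hN.opTrace_comp, ← hN.integral_inner_mul_inner, ← integral_const_mul]
  refine integral_congr_ae (ae_of_all _ fun z => ?_)
  simp [inner_smul_left, mul_assoc]

theorem steinOpC_cexpInner (hN : HasCovariance C N) (s : X) :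
    steinOpC C U (cexpInner s) = fun x => toComplex (scalarSymbol C U x s) := by
  funext x
  have h1 := (hasFDerivAt_comp_inner_smul s x (Real.hasDerivAt_sin _).neg).fderiv
  have h2 := (hasFDerivAt_comp_inner_smul s x (Real.hasDerivAt_cos _)).fderiv
  simp only [Pi.neg_apply] at h1
  simp only [steinOpC, cexpInner_re, cexpInner_im, steinOp, secondDeriv, gradient_cos_inner,
    gradient_sin_inner, h1, h2, hN.opTrace_comp_smulRight, toComplex_apply, inner_smul_left,
    conj_trivial]
  apply Complex.ext
  · change _ = -(inner ℝ (C s) s) * (Real.cos (inner ℝ s x) * 1) +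
      inner ℝ s (drift C U x) * (Real.sin (inner ℝ s x) * 1)
    ring
  · change _ = -(inner ℝ (C s) s) * (Real.sin (inner ℝ s x) * 1) +
      inner ℝ s (drift C U x) * -(Real.cos (inner ℝ s x) * 1)
    ring

theorem aestronglyMeasurable_scalarSymbol [SFinite Q] [SFinite μ]
    (hd : Integrable (drift C U) Q) :
    AEStronglyMeasurable (Function.uncurry (scalarSymbol C U)) (Q.prod μ) := by
  have : SecondCountableTopology X := UniformSpace.secondCountable_of_separable X
  have h : Continuous fun p : X × X => -(inner ℝ (C p.2) p.2 : ℝ) := by fun_prop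
  have hf : AEStronglyMeasurable (fun p : X × X => feature (inner ℝ p.2 p.1) (1 : ℝ))
    (Q.prod μ) := aestronglyMeasurable_feature_prod aestronglyMeasurable_const
  have hin : AEStronglyMeasurable (fun p : X × X => (inner ℝ p.2 (drift C U p.1) : ℝ))
    (Q.prod μ) := continuous_snd.aestronglyMeasurable.inner hd.1.comp_fst
  exact (h.aestronglyMeasurable.smul hf).add
    (hin.smul (quarterTurn.continuous.comp_aestronglyMeasurable hf))

theorem integrable_scalarSymbol [IsProbabilityMeasure Q] (hd : Integrable (drift C U) Q) (s : X) :
    Integrable (fun x => scalarSymbol C U x s) Q := by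
  have : SecondCountableTopology X := UniformSpace.secondCountable_of_separable X
  have hf : AEStronglyMeasurable (fun x => feature (inner ℝ s x) (1 : ℝ)) Q :=
    (continuous_feature.comp (f := fun x => ((inner ℝ s x : ℝ), (1 : ℝ)))
      (by fun_prop)).aestronglyMeasurable
  have hin : Integrable (fun x => (inner ℝ s (drift C U x) : ℝ)) Q := hd.const_inner s
  have hm : AEStronglyMeasurable (fun x => scalarSymbol C U x s) Q :=
    (hf.const_smul (-(inner ℝ (C s) s : ℝ))).add
      (hin.1.smul (quarterTurn.continuous.comp_aestronglyMeasurable hf))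
  exact ((integrable_const |(inner ℝ (C s) s : ℝ)|).add hin.abs).mono' hm
    (ae_of_all _ fun x => norm_scalarSymbol_le C U x s)

theorem HasCovariance.abs_inner_apply_self (hN : HasCovariance C N) (s : X) :
    |(inner ℝ (C s) s : ℝ)| = ∫ z, |(inner ℝ s z : ℝ) * inner ℝ s z| ∂N := by
  simp only [abs_mul_self]
  rw [← hN.integral_inner_mul_inner, abs_of_nonneg]
  exact integral_nonneg fun z => mul_self_nonneg _

/-- The trace part `⟨C s, s⟩ = E_N⟨s, z⟩²` needs the fourth weak moment, the drift part `⟨s, drift⟩`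
only the second. -/
theorem scalarSymbol_bound [SFinite N] [IsFiniteMeasure μ] (hN : HasCovariance C N)
    (hM : HasWeakMoment μ 4) (hM2 : HasWeakMoment μ 2) :
    ∃ c B, ∀ x, ∀ q : Lp ℝ 2 μ, Integrable (fun s => ‖scalarSymbol C U x s‖ * ‖q s‖) μ ∧
      ∫ s, ‖scalarSymbol C U x s‖ * ‖q s‖ ∂μ ≤ (c + B * ‖drift C U x‖) * ‖q‖ := by
  have : SecondCountableTopology X := UniformSpace.secondCountable_of_separable X
  obtain ⟨B, hB0, hB⟩ := hM.exists_sqrt_bound_mul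
  obtain ⟨B', hB'0, hB'⟩ := hM2.exists_sqrt_bound
  refine ⟨B * ∫ z, ‖z‖ ^ 2 ∂N, B', fun x q => ?_⟩
  rw [add_mul]
  have h1 := (integrable_prod_of_sqrt_bound hN.integrable_norm_sq
    (κ := fun s z => (inner ℝ s z : ℝ) * inner ℝ s z) (by unfold Function.uncurry; fun_prop)
    (fun z => hM.memLp_inner_mul_inner z z) (fun z => by rw [sq ‖z‖]; exact hB z z) q).2
  simp only [← hN.abs_inner_apply_self] at h1
  obtain ⟨h2, h3⟩ := integral_abs_mul_norm_le (hM2.memLp_inner (drift C U x)) q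
  refine integrable_mul_and_le_of_le ?_ (Lp.aestronglyMeasurable q) (fun s => norm_nonneg _)
    (fun s => norm_scalarSymbol_le C U x s) h1
    ⟨h2, h3.trans (mul_le_mul_of_nonneg_right (hB' _) (norm_nonneg _))⟩
  have hf : Continuous fun s => feature (inner ℝ s x) (1 : ℝ) :=
    continuous_feature.comp (f := fun s => ((inner ℝ s x : ℝ), (1 : ℝ))) (by fun_prop)
  have hJ := quarterTurn.continuous.comp hf
  unfold scalarSymbol
  refine Continuous.aestronglyMeasurable (Continuous.norm (Continuous.add ?_ ?_))
  · exact (by fun_prop : Continuous fun s => -(inner ℝ (C s) s : ℝ)).smul hf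
  · exact (by fun_prop : Continuous fun s => (inner ℝ s (drift C U x) : ℝ)).smul hJ

/-- The action of the Stein operator on Fourier transforms. -/
theorem steinOp_transform [SFinite N] [IsFiniteMeasure μ] (hN : HasCovariance C N)
    (hM : HasWeakMoment μ 4) (hM2 : HasWeakMoment μ 2) (g : Lp (Complexification ℝ) 2 μ) :
    Differentiable ℝ (transform μ g) ∧ Differentiable ℝ (gradient (transform μ g)) ∧
    ∀ x, steinOp C U (transform μ g) x = ∫ s, inner ℝ (g s) (scalarSymbol C U x s) ∂μ := by
  have : SecondCountableTopology X := UniformSpace.secondCountable_of_separable X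
  obtain ⟨T, hT, hTd⟩ := hM2.exists_fderiv_transform g
  obtain ⟨T', hT', hTd'⟩ := hM.exists_fderiv_fderiv_transform hM2 g hT
  obtain ⟨B, hB0, hB⟩ := hM.exists_sqrt_bound_mul
  have hgrad := gradient_eq_rieszCLM hTd
  have hgd : ∀ x, HasFDerivAt (gradient (transform μ g)) (rieszCLM X ∘L T' x) x := fun x => by
    rw [hgrad]
    exact (rieszCLM X).hasFDerivAt.comp x (hTd' x)
  refine ⟨fun x => (hTd x).differentiableAt, fun x => (hgd x).differentiableAt, fun x => ?_⟩
  have hg : Integrable g μ := (Lp.memLp g).integrable (by norm_num)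
  have hgx := integrable_phase hg x
  have hprod : Integrable (fun p : X × X => -((inner ℝ p.2 p.1 : ℝ) * inner ℝ p.2 p.1 *
      phase (inner ℝ p.2 x) (g p.2))) (N.prod μ) := by
    refine ((integrable_prod_of_sqrt_bound hN.integrable_norm_sq
      (κ := fun s z => (inner ℝ s z : ℝ) * inner ℝ s z) (by unfold Function.uncurry; fun_prop)
      (fun z => hM.memLp_inner_mul_inner z z)
      (fun z => by rw [sq ‖z‖]; exact hB z z) g).1.mono' ?_ (ae_of_all _ fun p => ?_)).neg
    · exact (by fun_prop : Continuous fun p : X × X =>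
        (inner ℝ p.2 p.1 : ℝ) * inner ℝ p.2 p.1).aestronglyMeasurable.mul hgx.1.comp_snd
    · rw [norm_mul, Real.norm_eq_abs]
      gcongr
      exact norm_phase_le _ _
  have hcov : ∀ s, ∫ z, -((inner ℝ s z : ℝ) * inner ℝ s z * phase (inner ℝ s x) (g s)) ∂N =
      -(inner ℝ (C s) s * phase (inner ℝ s x) (g s)) := fun s => by
    rw [integral_neg, integral_mul_const, hN.integral_inner_mul_inner]
  have htr : opTrace (C ∘L secondDeriv (transform μ g) x) =
      ∫ s, -(inner ℝ (C s) s * phase (inner ℝ s x) (g s)) ∂μ := by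
    rw [hN.opTrace_comp, secondDeriv, (hgd x).fderiv]
    have h1 : ∀ z, (inner ℝ ((rieszCLM X ∘L T' x) z) z : ℝ) =
        ∫ s, -((inner ℝ s z : ℝ) * inner ℝ s z * phase (inner ℝ s x) (g s)) ∂μ := fun z => by
      rw [ContinuousLinearMap.comp_apply, inner_rieszCLM, hT', transform]
      refine integral_congr_ae (ae_of_all _ fun s => ?_)
      simp only [derivSymbol, map_smul, quarterTurn_quarterTurn, map_neg, smul_eq_mul]
      ring
    -- The trace is now a Gaussian average of spectral integrals; the weak fourth moment behind
    -- `hprod` permits the exchange.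
    simp only [h1]
    rw [integral_integral_swap (f := fun z s => -((inner ℝ s z : ℝ) * inner ℝ s z *
      phase (inner ℝ s x) (g s))) hprod]
    exact integral_congr_ae (ae_of_all _ hcov)
  have hi1 : Integrable (fun s => -((inner ℝ (C s) s : ℝ) * phase (inner ℝ s x) (g s))) μ := by
    have := hprod.integral_prod_right
    simpa only [hcov] using this
  rw [steinOp, htr, hgrad, inner_rieszCLM, hT, transform,
    ← integral_sub hi1 (integrable_phase (hM2.derivSymbol_bounds g _).1 x)]
  refine integral_congr_ae (ae_of_all _ fun s => ?_)
  simp only [inner_scalarSymbol, derivSymbol]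

end Scalar

end SpectralKSD

end

theorem theorem3 {X : Type*} [NormedAddCommGroup X] [InnerProductSpace ℝ X] [CompleteSpace X]
    [TopologicalSpace.SeparableSpace X] [MeasurableSpace X] [BorelSpace X]
    (C : X →L[ℝ] X) (U : X → ℝ) (N P Q : Measure X)
    (hS : SpectralKSD.SteinSetting C U N P Q)
    (k : SpectralKSD.PDKernel X) (μ : Measure X) [IsFiniteMeasure μ]
    (hk : ∀ x y : X, (k x y : ℂ) = charFun μ (x - y)) :
    (SpectralKSD.IsCb 2 k →
      (∀ f : SpectralKSD.HilbertRKHS k ℝ,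
        Differentiable ℝ (f : X → ℝ) ∧ Differentiable ℝ (gradient (f : X → ℝ)) ∧
        (∀ x, SpectralKSD.IsTraceClass (C ∘L SpectralKSD.secondDeriv f x)) ∧
        Integrable (SpectralKSD.steinOp C U f) Q) ∧
      (∀ s : X, Integrable (SpectralKSD.steinOpC C U (SpectralKSD.cexpInner s)) Q) ∧
      SpectralKSD.ksd k (SpectralKSD.steinOp C U) Q ≠ ⊤ ∧
      SpectralKSD.ksd k (SpectralKSD.steinOp C U) Q ^ 2 =
        ∫⁻ s, ENNReal.ofReal
          (‖∫ x, SpectralKSD.steinOpC C U (SpectralKSD.cexpInner s) x ∂Q‖ ^ 2) ∂μ) ∧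
    (SpectralKSD.IsCb 1 k →
      (∀ F : SpectralKSD.HilbertRKHS k X,
        Differentiable ℝ (F : X → X) ∧
        (∀ x, SpectralKSD.IsTraceClass (C ∘L fderiv ℝ F x)) ∧
        Integrable (SpectralKSD.vecSteinOp C U F) Q) ∧
      (∀ s : X, Integrable (SpectralKSD.gammaOpC C U (SpectralKSD.cexpInner s)) Q) ∧
      SpectralKSD.ksd k (SpectralKSD.vecSteinOp C U) Q ≠ ⊤ ∧
      SpectralKSD.ksd k (SpectralKSD.vecSteinOp C U) Q ^ 2 =
        ∫⁻ s, ENNReal.ofReal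
          (‖∫ x, SpectralKSD.gammaOpC C U (SpectralKSD.cexpInner s) x ∂Q‖ ^ 2) ∂μ) := by
  open SpectralKSD in
  have hQ := hS.isProbabilityMeasure_candidate
  have hNp := hS.gaussian.isProbabilityMeasure
  have hN := hS.gaussian.hasCovariance hS.isPositive hS.isTraceClass
  have hd := integrable_drift hS.measurable_potential hS.differentiable_ae_candidate
    hS.candidate_moment hS.candidate_potential
  refine ⟨fun hk2 => ?_, fun hk1 => ?_⟩
  · have hM4 := hasWeakMoment_four hk hk2
    have hM2 := hasWeakMoment_two hk (hk2.mono one_le_two)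
    obtain ⟨c, B, hb⟩ := scalarSymbol_bound (U := U) hN hM4 hM2
    obtain ⟨hA, hfin, hsq⟩ := ksd_sq_eq_lintegral hk (A := steinOp C U)
      (aestronglyMeasurable_scalarSymbol hd)
      ((integrable_const c).add (hd.norm.const_mul B)) hb
      fun g => (steinOp_transform hN hM4 hM2 g).2.2
    obtain ⟨J, hJ, -⟩ := exists_spectral_isometry (V := ℝ) hk
    refine ⟨fun f => ?_, fun s => ?_, hfin, ?_⟩
    · rw [show (f : X → ℝ) = transform μ (J f) from funext (hJ f)]
      have h := steinOp_transform (U := U) hN hM4 hM2 (J f)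
      exact ⟨h.1, h.2.1, fun x => hN.isTraceClass_comp _, hA _⟩
    · rw [steinOpC_cexpInner hN]
      exact toComplex.integrable_comp (integrable_scalarSymbol hd s)
    · rw [hsq]
      refine lintegral_congr fun s => ?_
      rw [steinOpC_cexpInner hN, toComplex.integral_comp_comm (integrable_scalarSymbol hd s),
        norm_toComplex]
  · have hM2 := hasWeakMoment_two hk hk1
    obtain ⟨c, hb⟩ := vecSymbol_bound (U := U) hN hM2
    obtain ⟨hA, hfin, hsq⟩ := ksd_sq_eq_lintegral hk (A := vecSteinOp C U)
      (aestronglyMeasurable_vecSymbol hd)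
      ((integrable_const c).add (hd.norm.const_mul _)) hb (vecSteinOp_transform hN hM2)
    obtain ⟨J, hJ, -⟩ := exists_spectral_isometry (V := X) hk
    refine ⟨fun F => ?_, fun s => ?_, hfin, ?_⟩
    · rw [show (F : X → X) = transform μ (J F) from funext (hJ F)]
      obtain ⟨T, -, hT⟩ := hM2.exists_fderiv_transform (J F)
      exact ⟨fun x => (hT x).differentiableAt, fun x => hN.isTraceClass_comp _, hA _⟩
    · rw [gammaOpC_cexpInner]
      exact integrable_vecSymbol hd s
    · rw [hsq]
      refine lintegral_congr fun s => ?_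
      rw [gammaOpC_cexpInner]
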